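/- **Setting.** Let $\kappa$ be the security parameter, let $\ell=\ell(\kappa)$ and $m=m(\kappa)=2^{\ell_m(\kappa)}$ be polynomially bounded, and let $\mathbb F=\mathbb F_{2^\ell}$ (elements written as $\ell$-bit strings, addition is XOR). Indices in $[m]$ are $\ell_m$-bit strings. "Efficient" means non-uniform probabilistic polynomial time (families of polynomial-size Boolean circuits with polynomially many random input bits). Three parties $P_0,P_1,P_2$ (indices modulo 3) are connected by private synchronous channels. A replicated sharing $\langle x\rangle$ of $x=x_0+x_1+x_2$ gives $P_i$ the pair $(x_i,x_{i-1})$. Let $F:\{0,1\}^\kappa\times\{0,1\}^\kappa\to\mathbb F$ be a secure PRF: it is efficiently computable, and for uniform $k$ no efficient oracle algorithm distinguishes $F(k,\cdot)$ from a uniformly random function with non-negligible advantage. Independent uniform keys $k_0,k_1,k_2$ are set up such that $P_i$ holds $k_i$ and $k_{i-1}$. **Hybrid functionalities.** When $P_c$ is corrupted, the adversary may make any of these functionalities abort (all parties then abort), and whenever one of them outputs a sharing, the adversary chooses the pair of $P_c$; with no corrupted party, the sharings are uniformly random. $\mathcal F_{\rm rand}$ outputs a sharing of a uniformly random value. $\mathcal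 F_{\rm 3pc}^{\mathbb F_2}$ outputs a sharing of $f(x)$, given a sharing of $x$, for a function $f$ on vectors over $\mathbb F_2$. $\mathcal F_{\rm open}$ reveals the shared value to the adversary, and then, unless the adversary aborts, to all parties. **Protocol $\Pi_{\rm rss\text{-}os}$.** Inputs: a session identifier $\mathsf{sid}\in\{0,1\}^\kappa$ and consistent replicated sharings $\langle T\rangle$ of $T\in\mathbb F^m$ and $\langle\mathit{idx}\rangle$ of $\mathit{idx}\in[m]$. 1. Preprocessing: $\langle\mathit{rdx}\rangle\leftarrow\mathcal F_{\rm rand}$ with $\mathit{rdx}\in\{0,1\}^{\ell_m}$, and $\langle v\rangle\leftarrow\mathcal F_{\rm 3pc}^{\mathbb F_2}$, where $v\in\mathbb F_2^m$ is the vector whose only $1$ is at position $\mathit{rdx}$. 2. Open $\Delta=\mathit{rdx}\oplus\mathit{idx}$ with $\mathcal F_{\rm open}$, and put $\langle u[j]\rangle=\langle v[j\oplus\Delta]\rangle$ for $j\in[m]$. 3. $P_i$ computes $t_i=\sum_{j}\big(u_i[j]T_i[j]+u_{i-1}[j]T_i[j]+u_i[j]T_{i-1}[j]\big)$ and $s_i=t_i+F(k_i,\mathsf{sid})-F(k_{i-1},\mathsf{sid})$,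 and sends $s_i$ to $P_{i+1}$. $P_i$ outputs $(s_i,s_{i-1})$, with $s_{i-1}$ as received. A corrupted party may send any $\ell$-bit string in step 3 (anything else, or silence, is read as such a string), and may do so after having received its own message. **Functionality $\mathcal F_{\rm os}$ (additive attacks).** It reconstructs $T$ and $\mathit{idx}$ from the shares of the honest parties. If no party is corrupted, it outputs a uniformly random sharing of $T[\mathit{idx}]$. If $P_c$ is corrupted, it draws a uniform $\rho\in\mathbb F$ and gives it to the adversary, which either aborts (then all honest parties abort) or answers with an error $e\in\mathbb F$ and a share $\sigma\in\mathbb F$; the honest parties then receive their pairs of the sharing of $T[\mathit{idx}]+e$ with $s_{c-1}=\rho$, $s_c=\sigma$, $s_{c+1}=T[\mathit{idx}]+e-\rho-\sigma$. **Theorem.** If $F$ is a secure PRF, then $\Pi_{\rm rss\text{-}os}$ securely computes $\mathcal F_{\rm os}$ with abort in the $(\mathcal F_{\rm rand},\mathcal F_{\rm 3pc}^{\mathbb F_2},\mathcal F_{\rm open})$-hybrid model against a static malicious adversary corrupting at most one of the three parties. That is: (i) for every $c\in\{0,1,2\}$ and every efficient malicious rushing adversary $\mathcal A$ corrupting $P_c$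 there is an efficient simulator $\mathcal S$, which has only the input pairs of $P_c$, $\mathsf{sid}$ and its interaction with $\mathcal F_{\rm os}$, such that for all families of inputs the joint distribution of the honest parties' outputs and the output of $\mathcal A$ in the execution of the protocol is computationally indistinguishable from that of the honest parties' outputs and the output of $\mathcal S$ in the ideal execution with $\mathcal F_{\rm os}$; (ii) for all families of inputs, if all parties are honest, the outputs of the three parties in the protocol are computationally indistinguishable from those of $\mathcal F_{\rm os}$. -/

import Mathlib

namespace ObliviousSelection

/-! ## Bits and Boolean circuits -/

/-- The field with two elements; its elements serve as bits, and addition is XOR. -/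
abbrev F2 : Type := ZMod 2

/-- Bit strings of length `n`. The field with `2 ^ l` elements is represented by the coordinate
vectors `Str l` with respect to a basis over `F2`: the protocol only adds field elements and
multiplies them by elements of `F2`. The index set `[m]` with `m = 2 ^ lm` is `Str lm` (binary
expansions), so that XOR of indices is addition. -/
abbrev Str (n : ℕ) : Type := Fin n → F2

/-- Types whose elements are written as bit strings. -/
class Bits (α : Type) where
  Idx : Type
  enc : α → Idx → F2
  inj : Function.Injective enc

instance : Bits F2 where
  Idx := Unit
  enc b := fun _ => b
  inj _ _ h := congrFun h ()

instance {ι α : Type} [Bits α] : Bits (ι → α) where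
  Idx := ι × Bits.Idx α
  enc x := fun p => Bits.enc (x p.1) p.2
  inj x y h := by
    funext i
    exact Bits.inj (funext fun j => congrFun h (i, j))

instance {α β : Type} [Bits α] [Bits β] : Bits (α × β) where
  Idx := Bits.Idx α ⊕ Bits.Idx β
  enc x := Sum.elim (Bits.enc x.1) (Bits.enc x.2)
  inj x y h := by
    refine Prod.ext (Bits.inj (funext fun i => ?_)) (Bits.inj (funext fun i => ?_))
    · exact congrFun h (Sum.inl i)
    · exact congrFun h (Sum.inr i)

/-- A presence bit (in position `none`), followed by the content or by zeros. -/
instance {α : Type} [Bits α] : Bits (Option α) where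
  Idx := Option (Bits.Idx α)
  enc x := fun i => match x, i with
    | none, _ => 0
    | some _, none => 1
    | some a, some i => Bits.enc a i
  inj x y h := by
    cases x with
    | none =>
      cases y with
      | none => rfl
      | some b => exact absurd (congrFun h none) zero_ne_one
    | some a =>
      cases y with
      | none => exact absurd (congrFun h none) one_ne_zero
      | some b => exact congrArg some (Bits.inj (funext fun i => congrFun h (some i)))

/-- Gates reading wires from `W`: constants, XOR, AND, and an oracle gate that
queries a function `(X → F2) → (Y → F2)` and returns one chosen bit of the answer. -/
inductive Gate (W X Y : Type) : Type where
  | const (b : F2) : Gate W X Y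
  | add (a b : W) : Gate W X Y
  | mul (a b : W) : Gate W X Y
  | query (x : X → W) (y : Y) : Gate W X Y

def Gate.eval {W X Y : Type} (O : (X → F2) → (Y → F2)) (w : W → F2) : Gate W X Y → F2
  | .const b => b
  | .add a b => w a + w b
  | .mul a b => w a * w b
  | .query x y => O (fun i => w (x i)) y

/-- Circuits (straight-line programs) with available wires `W` and output positions `o`. Each step
adds one gate, whose value becomes the new wire `none`. -/
inductive Circuit (X Y o : Type) : Type → Type 1 where
  | done {W : Type} (out : o → W) : Circuit X Y o W
  | step {W : Type} (g : Gate W X Y) (rest : Circuit X Y o (Option W)) : Circuit X Y o W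

/-- The number of gates. -/
def Circuit.size {X Y o : Type} : {W : Type} → Circuit X Y o W → ℕ
  | _, .done _ => 0
  | _, .step _ rest => rest.size + 1

def Circuit.eval {X Y o : Type} (O : (X → F2) → (Y → F2)) :
    {W : Type} → Circuit X Y o W → (W → F2) → (o → F2)
  | _, .done out, w => fun j => w (out j)
  | _, .step g rest, w => rest.eval O fun i => i.elim (g.eval O w) w

/-- `f` is computed by a Boolean circuit (without oracle: the oracle has no answer bits)
with at most `s` gates. -/
def ComputableIn {α β : Type} [Bits α] [Bits β] (s : ℕ) (f : α → β) : Prop :=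
  ∃ C : Circuit Empty Empty (Bits.Idx β) (Bits.Idx α), C.size ≤ s ∧
    ∀ x, Bits.enc (f x) = C.eval (fun _ y => y.elim) (Bits.enc x)

/-! ## Asymptotics and computational indistinguishability -/

def PolyBounded (p : ℕ → ℕ) : Prop :=
  ∃ P : Polynomial ℕ, ∀ κ, p κ ≤ P.eval κ

/-- A family of functions computed by circuits of polynomial size (non-uniform polynomial time). -/
def PolySize {α β : ℕ → Type} [∀ κ, Bits (α κ)] [∀ κ, Bits (β κ)]
    (f : ∀ κ, α κ → β κ) : Prop :=
  ∃ s : ℕ → ℕ, PolyBounded s ∧ ∀ κ, ComputableIn (s κ) (f κ)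

def Negligible (ε : ℕ → ℝ) : Prop :=
  Asymptotics.SuperpolynomialDecay Filter.atTop (fun κ : ℕ => (κ : ℝ)) ε

/-- The probability that a random bit equals `1`. -/
noncomputable def prOne (p : PMF F2) : ℝ := (p 1).toReal

/-- No probabilistic polynomial-size distinguisher tells the two ensembles apart. -/
def CompIndist {α : ℕ → Type} [∀ κ, Bits (α κ)] (P Q : ∀ κ, PMF (α κ)) : Prop :=
  ∀ (r : ℕ → ℕ) (D : ∀ κ, α κ × Str (r κ) → F2), PolyBounded r → PolySize D →
    Negligible fun κ =>
      |prOne (do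
          let a ← P κ
          let ω ← PMF.uniformOfFintype (Str (r κ))
          return D κ (a, ω)) -
        prOne (do
          let a ← Q κ
          let ω ← PMF.uniformOfFintype (Str (r κ))
          return D κ (a, ω))|

/-- Keys and inputs are strings of length `κ`, outputs are strings of length `l κ`. The function is
efficiently computable, and no probabilistic polynomial-size oracle circuit distinguishes
`F κ k`, for a uniform key `k`, from a uniformly random function. -/
def IsSecurePRF {l : ℕ → ℕ} (F : ∀ κ, Str κ → Str κ → Str (l κ)) : Prop :=
  PolySize (fun κ (x : Str κ × Str κ) => F κ x.1 x.2) ∧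
  ∀ (r : ℕ → ℕ) (D : ∀ κ, Circuit (Fin κ) (Fin (l κ)) Unit (Fin (r κ))),
    PolyBounded r → PolyBounded (fun κ => (D κ).size) →
    Negligible fun κ =>
      |prOne (do
          let k ← PMF.uniformOfFintype (Str κ)
          let ω ← PMF.uniformOfFintype (Str (r κ))
          return (D κ).eval (F κ k) ω ()) -
        prOne (do
          let f ← PMF.uniformOfFintype (Str κ → Str (l κ))
          let ω ← PMF.uniformOfFintype (Str (r κ))
          return (D κ).eval f ω ())|

/-! ## Replicated secret sharing -/

/-- A consistent replicated sharing `x = x 0 + x 1 + x 2`; party `i` holds `piece x i`. -/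
abbrev RSS (α : Type) : Type := Fin 3 → α

/-- What party `i` holds: the pair `(x i, x (i - 1))`, indices modulo 3. -/
def piece {α : Type} (x : RSS α) (i : Fin 3) : α × α := (x i, x (i - 1))

def reconstruct {α : Type} [AddCommGroup α] (x : RSS α) : α := ∑ i, x i

/-- The sharing of `val` in which party `c` holds the pair `a`. -/
def complete {α : Type} [AddCommGroup α] (c : Fin 3) (a : α × α) (val : α) : RSS α :=
  fun i => if i = c then a.1 else if i = c - 1 then a.2 else val - a.1 - a.2

/-- A uniformly random sharing of `val`. -/
noncomputable def freshSharing {α : Type} [AddCommGroup α] [Fintype α] (val : α) :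
    PMF (RSS α) := do
  let a ← PMF.uniformOfFintype (α × α)
  return complete 0 a val

/-! ## Ideal functionalities

A corrupted party is called `c`. As usual for functionalities that output sharings, the adversary
picks the piece of `c`; the rest of the sharing is then fixed by the shared value. The answer
`none` of the adversary means that it makes the functionality abort, for all parties. -/

/-- Sharing of a uniformly random value; `a` is the piece picked by the adversary. -/
noncomputable def fRand {α : Type} [AddCommGroup α] [Fintype α] (c : Fin 3) (a : α × α) :
    PMF (RSS α) := do
  let r ← PMF.uniformOfFintype α
  return complete c a r

/-- Three-party computation over `F2`: from a sharing of `x`, a sharing of `f x`. -/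
def f3pc {ι ι' : Type} (f : (ι → F2) → (ι' → F2)) (c : Fin 3) (a : (ι' → F2) × (ι' → F2))
    (x : RSS (ι → F2)) : RSS (ι' → F2) :=
  complete c a (f (reconstruct x))

/-- The value that is opened to all parties. -/
def fOpen {α : Type} [AddCommGroup α] (x : RSS α) : α := reconstruct x

/-- An array of `2 ^ lm` elements of the field with `2 ^ l` elements. -/
abbrev Arr (lm l : ℕ) : Type := Str lm → Str l

/-- Inputs: consistent sharings of the array and of the index, and the session identifier. -/
structure Input (κ lm l : ℕ) where
  T : RSS (Arr lm l)
  idx : RSS (Str lm)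
  sid : Str κ

/-- The selected element `T[idx]`. -/
def Input.selected {κ lm l : ℕ} (x : Input κ lm l) : Str l :=
  reconstruct x.T (reconstruct x.idx)

/-- Oblivious selection up to additive attacks. `ρ` is a fresh uniform share, drawn by the
functionality and given to the adversary. The adversary answers with an error `e` and the
other share `σ` of party `c`, or aborts. The result is a sharing of `T[idx] + e`. -/
def fOs {κ lm l : ℕ} (c : Fin 3) (x : Input κ lm l) (ρ : Str l) (ans : Option (Str l × Str l)) :
    Option (RSS (Str l)) :=
  ans.map fun a => complete c (a.2, ρ) (x.selected + a.1)

/-! ## The protocol -/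

/-- The vector with a single `1`, at position `p`. -/
def unitVec {lm : ℕ} (p : Str lm) : Str lm → F2 := fun j => if j = p then 1 else 0

/-- Local inner product: from pieces of the array `T` and of the preprocessed vector `v`, and the
opened `Δ`, the additive share of `∑ j, u j • T j`, where `u j = v (j ⊕ Δ)`. -/
def innerShare {lm l : ℕ} (T : Arr lm l × Arr lm l) (v : (Str lm → F2) × (Str lm → F2))
    (Δ : Str lm) : Str l :=
  ∑ j, (v.1 (j + Δ) • T.1 j + v.2 (j + Δ) • T.1 j + v.1 (j + Δ) • T.2 j)

/-- The share `s i = t i + r i`, as computed by party `i` from its pieces; `k = (k i, k (i - 1))`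
are the two keys it holds, and `r i = F (k i) sid - F (k (i - 1)) sid`. -/
def maskedShare {κ lm l : ℕ} (F : Str κ → Str κ → Str l) (sid : Str κ) (k : Str κ × Str κ)
    (T : Arr lm l × Arr lm l) (v : (Str lm → F2) × (Str lm → F2)) (Δ : Str lm) : Str l :=
  innerShare T v Δ + (F k.1 sid - F k.2 sid)

/-! ## Executions with a corrupted party -/

/-- Input of the corrupted party: its pieces of the array and of the index, and the session
identifier. -/
abbrev PartyInput (κ lm l : ℕ) : Type := (Arr lm l × Arr lm l) × (Str lm × Str lm) × Str κ

def Input.party {κ lm l : ℕ} (x : Input κ lm l) (c : Fin 3) : PartyInput κ lm l :=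
  (piece x.T c, piece x.idx c, x.sid)

/-- What a real-world adversary with `r` coins knows initially: the keys and the input of
the corrupted party, and its coins. -/
abbrev InitialView (κ lm l r : ℕ) : Type := (Str κ × Str κ) × PartyInput κ lm l × Str r

/-- Outputs of the two honest parties `c + 1` and `c - 1` (`none` if they abort), together with the
`w`-bit output of the adversary. -/
abbrev Outcome (l w : ℕ) : Type := Option ((Str l × Str l) × (Str l × Str l)) × Str w

/-- A (rushing) malicious real-world adversary with output length `w`. In each round it may use
all that it has seen so far. -/
structure Adversary (κ lm l w : ℕ) where
  coins : ℕ
  /-- piece of the sharing of `rdx`, or abort -/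
  rand : InitialView κ lm l coins → Option (Str lm × Str lm)
  /-- piece of the sharing of the unit vector, or abort -/
  unit : InitialView κ lm l coins → Option ((Str lm → F2) × (Str lm → F2))
  /-- after having seen `Δ`: let the opening succeed (`1`), or abort (`0`) -/
  opens : InitialView κ lm l coins × Str lm → F2
  /-- the message to party `c + 1`, after having seen `Δ` and the message of party `c - 1` -/
  send : InitialView κ lm l coins × Str lm × Str l → Str l
  /-- the output; the received messages are `none` if the execution aborts before them -/
  out : InitialView κ lm l coins × Option (Str lm) × Option (Str l) → Str w

/-- The execution of the protocol in the hybrid model, where party `c` is corrupted. The message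
of party `c` is a string of length `l` (anything else is read as such a string). -/
noncomputable def realExec {κ lm l w : ℕ} (F : Str κ → Str κ → Str l) (c : Fin 3)
    (A : Adversary κ lm l w) (x : Input κ lm l) : PMF (Outcome l w) := do
  let k ← PMF.uniformOfFintype (RSS (Str κ))
  let ω ← PMF.uniformOfFintype (Str A.coins)
  let view : InitialView κ lm l A.coins := (piece k c, x.party c, ω)
  match A.rand view with
  | none => return (none, A.out (view, none, none))
  | some a => do
    let rdx ← fRand c a
    match A.unit view with
    | none => return (none, A.out (view, none, none))
    | some b =>
      let v : RSS (Str lm → F2) := f3pc unitVec c b rdx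
      let Δ : Str lm := fOpen (rdx + x.idx)
      if A.opens (view, Δ) = 0 then
        return (none, A.out (view, some Δ, none))
      else
        let s : Fin 3 → Str l := fun i =>
          maskedShare F x.sid (piece k i) (piece x.T i) (piece v i) Δ
        let σ : Str l := A.send (view, Δ, s (c - 1))
        -- party `i` outputs its own share and the one received from party `i - 1`
        return (some ((s (c + 1), σ), (s (c - 1), s (c + 1))),
          A.out (view, some Δ, some (s (c - 1))))

/-- A simulator (ideal-world adversary) with output length `w`. -/
structure Simulator (κ lm l w : ℕ) where
  coins : ℕ
  /-- answer to the functionality: error and own share, or abort -/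
  answer : PartyInput κ lm l × Str coins × Str l → Option (Str l × Str l)
  out : PartyInput κ lm l × Str coins × Str l → Str w

/-- The ideal execution, where party `c` is corrupted. -/
noncomputable def idealExec {κ lm l w : ℕ} (c : Fin 3) (S : Simulator κ lm l w)
    (x : Input κ lm l) : PMF (Outcome l w) := do
  let ω ← PMF.uniformOfFintype (Str S.coins)
  let ρ ← PMF.uniformOfFintype (Str l)
  let view := (x.party c, ω, ρ)
  return ((fOs c x ρ (S.answer view)).map fun s => (piece s (c + 1), piece s (c - 1)),
    S.out view)

/-- Non-uniform probabilistic polynomial time for families of adversaries. -/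
structure PolyAdversary {lm l w : ℕ → ℕ} (A : ∀ κ, Adversary κ (lm κ) (l κ) (w κ)) : Prop where
  coins : PolyBounded fun κ => (A κ).coins
  rand : PolySize fun κ => (A κ).rand
  unit : PolySize fun κ => (A κ).unit
  opens : PolySize fun κ => (A κ).opens
  send : PolySize fun κ => (A κ).send
  out : PolySize fun κ => (A κ).out

/-- Non-uniform probabilistic polynomial time for families of simulators. -/
structure PolySimulator {lm l w : ℕ → ℕ} (S : ∀ κ, Simulator κ (lm κ) (l κ) (w κ)) : Prop where
  coins : PolyBounded fun κ => (S κ).coins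
  answer : PolySize fun κ => (S κ).answer
  out : PolySize fun κ => (S κ).out

/-! ## Executions without corrupted parties -/

/-- The outputs of the three parties when all of them are honest. -/
noncomputable def realHonest {κ lm l : ℕ} (F : Str κ → Str κ → Str l) (x : Input κ lm l) :
    PMF (Fin 3 → Str l × Str l) := do
  let k ← PMF.uniformOfFintype (RSS (Str κ))
  let r ← PMF.uniformOfFintype (Str lm)
  let rdx ← freshSharing r
  let v ← freshSharing (unitVec (reconstruct rdx))
  let Δ : Str lm := fOpen (rdx + x.idx)
  let s : RSS (Str l) := fun i =>
    maskedShare F x.sid (piece k i) (piece x.T i) (piece v i) Δ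
  return piece s

/-- The functionality when all parties are honest: a fresh sharing of `T[idx]`. -/
noncomputable def idealHonest {κ lm l : ℕ} (x : Input κ lm l) :
    PMF (Fin 3 → Str l × Str l) := do
  let s ← freshSharing x.selected
  return piece s

/-- The protocol securely computes oblivious selection up to additive attacks, with abort, against
static malicious adversaries that corrupt at most one of the three parties. -/
def SecurelyComputesOS (lm l : ℕ → ℕ) (F : ∀ κ, Str κ → Str κ → Str (l κ)) : Prop :=
  (∀ (c : Fin 3) (w : ℕ → ℕ) (A : ∀ κ, Adversary κ (lm κ) (l κ) (w κ)),
    PolyBounded w → PolyAdversary A →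
    ∃ S : ∀ κ, Simulator κ (lm κ) (l κ) (w κ), PolySimulator S ∧
      ∀ x : ∀ κ, Input κ (lm κ) (l κ),
        CompIndist (fun κ => realExec (F κ) c (A κ) (x κ)) (fun κ => idealExec c (S κ) (x κ))) ∧
  ∀ x : ∀ κ, Input κ (lm κ) (l κ),
    CompIndist (fun κ => realHonest (F κ) (x κ)) (fun κ => idealHonest (x κ))

end ObliviousSelection

namespace ObliviousSelection

/-! ## Composition of circuits -/

section Circuits

variable {X Y : Type}

/-! Whatever the masks are, they cancel around the cycle, and the local products cover all nine
cross terms of the two sharings; so the honestly computed shares always add up to `T[idx]`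
(`sum_shares`). Suppose `c` is corrupted. The one key it lacks is that of index `c + 1`, whose
pseudorandom value is subtracted in the share `s (c - 1)` that `c` receives. Once this value is
replaced by a uniform string, that share is uniform, like the `ρ` of the functionality, and `s (c +
1)` is forced by the sum. The simulator draws the two keys of `c` and a uniform `Δ` (the opening is
a one-time pad on `idx`), runs the adversary on `ρ`, and computes the honest `s c` from what `c`
holds. With the error `σ - s c` the functionality gives the honest parties exactly the real shares,
so the simulation is perfect (`expect_outcome`). With no corruption, two values are replaced one
after the other, those of the keys `0` and `2`; shares `0` and `2` are then independent and uniform,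
and share `1` is forced (`expect_shares`). Each replacement is one use of the PRF assumption. All
probabilities are written as finite averages, the key in question is drawn afresh
(`expect_resample`), and every other random choice is fixed to the value with the largest gap and
built into the circuit (`IsSecurePRF.negligible_of_feasible`). What is left is a polynomial-size
circuit that reads one PRF value. The notion `Feasible` serves this: its size bound is the same
polynomial for all built-in constants. It also yields the efficiency of the simulator. -/

def Gate.rename {W V : Type} (φ : W → V) : Gate W X Y → Gate V X Y
  | .const b => .const b
  | .add a b => .add (φ a) (φ b)
  | .mul a b => .mul (φ a) (φ b)
  | .query x y => .query (φ ∘ x) y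

theorem Gate.eval_rename {W V : Type} (O : (X → F2) → (Y → F2)) (φ : W → V) (w : V → F2)
    (g : Gate W X Y) : (g.rename φ).eval O w = g.eval O (w ∘ φ) := by
  cases g <;> rfl

/-- Read the inputs from other wires. -/
def Circuit.rename {o : Type} : {W V : Type} → (W → V) → Circuit X Y o W → Circuit X Y o V
  | _, _, φ, .done out => .done (φ ∘ out)
  | _, _, φ, .step g rest => .step (g.rename φ) (rest.rename (Option.map φ))

theorem Circuit.size_rename {o W V : Type} (φ : W → V) (C : Circuit X Y o W) :
    (C.rename φ).size = C.size := by
  induction C generalizing V with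
  | done out => rfl
  | step g rest ih => simp [Circuit.rename, Circuit.size, ih]

theorem Circuit.eval_rename {o W V : Type} (O : (X → F2) → (Y → F2)) (φ : W → V)
    (C : Circuit X Y o W) (w : V → F2) : (C.rename φ).eval O w = C.eval O (w ∘ φ) := by
  induction C generalizing V with
  | done out => rfl
  | step g rest ih =>
    simp only [Circuit.rename, Circuit.eval, ih, Gate.eval_rename]
    congr 1
    funext i
    cases i <;> rfl

/-- Sequential composition. -/
def Circuit.bind {o o' : Type} : {W : Type} → Circuit X Y o W → Circuit X Y o' o →
    Circuit X Y o' W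
  | _, .done out, D => D.rename out
  | _, .step g rest, D => .step g (rest.bind D)

theorem Circuit.size_bind {o o' W : Type} (C : Circuit X Y o W) (D : Circuit X Y o' o) :
    (C.bind D).size = C.size + D.size := by
  induction C with
  | done out => simp [Circuit.bind, Circuit.size, Circuit.size_rename]
  | step g rest ih => simp [Circuit.bind, Circuit.size, ih]; omega

theorem Circuit.eval_bind {o o' W : Type} (O : (X → F2) → (Y → F2)) (C : Circuit X Y o W)
    (D : Circuit X Y o' o) (w : W → F2) : (C.bind D).eval O w = D.eval O (C.eval O w) := by
  induction C with
  | done out => simp only [Circuit.bind, Circuit.eval_rename]; rfl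
  | step g rest ih => simp [Circuit.bind, Circuit.eval, ih]

/-- Output some wires in addition. -/
def Circuit.keep {o o' : Type} : {W : Type} → (o → W) → Circuit X Y o' W →
    Circuit X Y (o ⊕ o') W
  | _, sel, .done out => .done (Sum.elim sel out)
  | _, sel, .step g rest => .step g (rest.keep (some ∘ sel))

theorem Circuit.size_keep {o o' W : Type} (sel : o → W) (C : Circuit X Y o' W) :
    (C.keep sel).size = C.size := by
  induction C with
  | done out => rfl
  | step g rest ih => simp [Circuit.keep, Circuit.size, ih]

theorem Circuit.eval_keep {o o' W : Type} (O : (X → F2) → (Y → F2)) (sel : o → W)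
    (C : Circuit X Y o' W) (w : W → F2) :
    (C.keep sel).eval O w = Sum.elim (w ∘ sel) (C.eval O w) := by
  induction C with
  | done out => funext i; cases i <;> rfl
  | step g rest ih => simp only [Circuit.keep, Circuit.eval, ih]; rfl

/-- Parallel composition. -/
def Circuit.pair {o o' : Type} : {W : Type} → Circuit X Y o W → Circuit X Y o' W →
    Circuit X Y (o ⊕ o') W
  | _, .done out, D => D.keep out
  | _, .step g rest, D => .step g (rest.pair (D.rename some))

theorem Circuit.size_pair {o o' W : Type} (C : Circuit X Y o W) (D : Circuit X Y o' W) :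
    (C.pair D).size = C.size + D.size := by
  induction C with
  | done out => simp [Circuit.pair, Circuit.size, Circuit.size_keep]
  | step g rest ih => simp [Circuit.pair, Circuit.size, ih, Circuit.size_rename]; omega

theorem Circuit.eval_pair {o o' W : Type} (O : (X → F2) → (Y → F2)) (C : Circuit X Y o W)
    (D : Circuit X Y o' W) (w : W → F2) :
    (C.pair D).eval O w = Sum.elim (C.eval O w) (D.eval O w) := by
  induction C with
  | done out => simp only [Circuit.pair, Circuit.eval_keep]; rfl
  | step g rest ih => simp only [Circuit.pair, Circuit.eval, ih, Circuit.eval_rename]; rfl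

/-- A gate of a circuit without oracle, as a gate of a circuit with oracle. -/
def Gate.lift {W : Type} : Gate W Empty Empty → Gate W X Y
  | .const b => .const b
  | .add a b => .add a b
  | .mul a b => .mul a b
  | .query _ y => y.elim

/-- A circuit without oracle, as a circuit with oracle. -/
def Circuit.lift {o : Type} : {W : Type} → Circuit Empty Empty o W → Circuit X Y o W
  | _, .done out => .done out
  | _, .step g rest => .step g.lift rest.lift

theorem Circuit.size_lift {o W : Type} (C : Circuit Empty Empty o W) :
    (C.lift : Circuit X Y o W).size = C.size := by
  induction C with
  | done out => rfl
  | step g rest ih => simp [Circuit.lift, Circuit.size, ih]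

theorem Circuit.eval_lift {o W : Type} (O : (X → F2) → (Y → F2))
    (O' : (Empty → F2) → (Empty → F2)) (C : Circuit Empty Empty o W) (w : W → F2) :
    (C.lift : Circuit X Y o W).eval O w = C.eval O' w := by
  induction C with
  | done out => rfl
  | step g rest ih =>
    have h : (g.lift : Gate _ X Y).eval O w = g.eval O' w := by
      cases g with
      | query _ y => exact y.elim
      | _ => rfl
    simp only [Circuit.lift, Circuit.eval, ih, h]

/-- Constant outputs. -/
def Circuit.consts {o W : Type} (b : o → F2) : Circuit X Y o W :=
  -- After both gates the newest wire `none` carries 1, and `some none` carries 0.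
  .step (.const 0) (.step (.const 1) (.done fun i => if b i = 0 then some none else none))

theorem Circuit.eval_consts {o W : Type} (O : (X → F2) → (Y → F2)) (b : o → F2) (w : W → F2) :
    (Circuit.consts b : Circuit X Y o W).eval O w = b := by
  funext i
  have h : b i = 0 ∨ b i = 1 := by generalize b i = z; revert z; decide
  rcases h with h | h <;> simp [Circuit.consts, Circuit.eval, Gate.eval, h]

/-- Finitely many circuits in parallel. -/
theorem Circuit.exists_parallel {ι : Type} [Finite ι] {o W : Type} (s : ℕ)
    (C : ι → Circuit X Y o W) (hC : ∀ i, (C i).size ≤ s) :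
    ∃ D : Circuit X Y (ι × o) W, D.size ≤ Nat.card ι * s ∧
      ∀ O w p, D.eval O w p = (C p.1).eval O w p.2 := by
  revert C
  induction ι using Finite.induction_empty_option with
  | of_equiv e ih =>
    intro C hC
    obtain ⟨D, h1, h2⟩ := ih (fun i => C (e i)) fun i => hC _
    refine ⟨D.bind (.done fun p => (e.symm p.1, p.2)), ?_, fun O w p => ?_⟩
    · rw [Circuit.size_bind, ← Nat.card_congr e]; exact h1
    · rw [Circuit.eval_bind]; simp [Circuit.eval, h2]
  | h_empty =>
    intro C _
    exact ⟨.done fun p => p.1.elim, Nat.zero_le _, fun O w p => p.1.elim⟩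
  | h_option ih =>
    intro C hC
    obtain ⟨D, h1, h2⟩ := ih (fun i => C (some i)) fun i => hC _
    refine ⟨((C none).pair D).bind (.done fun p => match p with
      | (none, i) => Sum.inl i
      | (some j, i) => Sum.inr (j, i)), ?_, fun O w p => ?_⟩
    · rw [Circuit.size_bind, Circuit.size_pair, Finite.card_option, add_mul, one_mul]
      have := hC none
      simp only [Circuit.size]
      omega
    · rw [Circuit.eval_bind, Circuit.eval_pair]
      rcases p with ⟨_ | j, i⟩
      · rfl
      · simp [Circuit.eval, h2]

end Circuits

/-! ## Closure properties of the functions computed by small circuits -/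

namespace ComputableIn

variable {α β γ : Type} [Bits α] [Bits β] [Bits γ] {s t : ℕ}

theorem mono {f : α → β} (h : ComputableIn s f) (hst : s ≤ t) : ComputableIn t f :=
  let ⟨C, h1, h2⟩ := h
  ⟨C, h1.trans hst, h2⟩

theorem of_wires {f : α → β} (g : Bits.Idx β → Bits.Idx α)
    (h : ∀ x i, Bits.enc (f x) i = Bits.enc x (g i)) : ComputableIn 0 f :=
  ⟨.done g, le_rfl, fun x => funext (h x)⟩

theorem comp {g : β → γ} {f : α → β} (hg : ComputableIn t g) (hf : ComputableIn s f) :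
    ComputableIn (s + t) fun x => g (f x) := by
  obtain ⟨C, h1, h2⟩ := hf
  obtain ⟨D, h3, h4⟩ := hg
  refine ⟨C.bind D, ?_, fun x => ?_⟩
  · rw [Circuit.size_bind]; omega
  · rw [Circuit.eval_bind, ← h2, h4]

theorem prodMk {f : α → β} {g : α → γ} (hf : ComputableIn s f) (hg : ComputableIn t g) :
    ComputableIn (s + t) fun x => (f x, g x) := by
  obtain ⟨C, h1, h2⟩ := hf
  obtain ⟨D, h3, h4⟩ := hg
  refine ⟨C.pair D, ?_, fun x => ?_⟩
  · rw [Circuit.size_pair]; omega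
  · rw [Circuit.eval_pair, ← h2, ← h4]; rfl

theorem const (b : β) : ComputableIn 2 fun _ : α => b :=
  ⟨Circuit.consts (Bits.enc b), le_rfl, fun _ => (Circuit.eval_consts _ _ _).symm⟩

theorem add : ComputableIn 1 fun x : F2 × F2 => x.1 + x.2 :=
  ⟨.step (.add (.inl ()) (.inr ())) (.done fun _ => none), le_rfl, fun _ => rfl⟩

theorem mul : ComputableIn 1 fun x : F2 × F2 => x.1 * x.2 :=
  ⟨.step (.mul (.inl ()) (.inr ())) (.done fun _ => none), le_rfl, fun _ => rfl⟩

theorem some : ComputableIn 2 (Option.some : α → Option α) := by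
  -- The wires after one gate are indexed just like the encoding of an `Option`: the new wire `none`
  -- is the presence bit.
  refine ⟨.step (.const 1) (.done fun i => i), by simp [Circuit.size], fun x => ?_⟩
  funext i
  cases i <;> rfl

theorem pi {ι : Type} [Finite ι] {f : ι → α → β} (h : ∀ i, ComputableIn s (f i)) :
    ComputableIn (Nat.card ι * s) fun x i => f i x := by
  choose C h1 h2 using h
  obtain ⟨D, h3, h4⟩ := Circuit.exists_parallel s C h1
  refine ⟨D, h3, fun x => funext fun p => ?_⟩
  rw [h4, ← h2]
  rfl

theorem of_bits [Finite (Bits.Idx β)] {f : α → β}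
    (h : ∀ i, ComputableIn s fun x => Bits.enc (f x) i) :
    ComputableIn (Nat.card (Bits.Idx β) * s) f := by
  obtain ⟨C, h1, h2⟩ := pi h
  refine ⟨C.bind (.done fun i => (i, ())), ?_, fun x => ?_⟩
  · rw [Circuit.size_bind]; exact h1
  · rw [Circuit.eval_bind, ← h2]; rfl

/-- Each term costs its own `s` gates and one addition; the final 2 pays for the constant of the
empty sum. -/
theorem sum {ι : Type} {f : ι → α → F2} (h : ∀ i, ComputableIn s (f i)) (S : Finset ι) :
    ComputableIn (S.card * (s + 1) + 2) fun x => ∑ i ∈ S, f i x := by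
  classical
  induction S using Finset.induction_on with
  | empty => simpa using const (0 : F2)
  | insert i S hi ih =>
    simp only [Finset.sum_insert hi, Finset.card_insert_of_notMem hi]
    exact (add.comp ((h i).prodMk ih)).mono (by ring_nf; omega)

theorem prod {ι : Type} {f : ι → α → F2} (h : ∀ i, ComputableIn s (f i)) (S : Finset ι) :
    ComputableIn (S.card * (s + 1) + 2) fun x => ∏ i ∈ S, f i x := by
  classical
  induction S using Finset.induction_on with
  | empty => simpa using const (1 : F2)
  | insert i S hi ih =>
    simp only [Finset.prod_insert hi, Finset.card_insert_of_notMem hi]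
    exact (mul.comp ((h i).prodMk ih)).mono (by ring_nf; omega)

end ComputableIn

/-! ## Families of functions computed by circuits of polynomial size -/

/-- `p` is bounded by a polynomial in `n`. -/
def PolyIn {J : Type} (n p : J → ℕ) : Prop :=
  ∃ P : Polynomial ℕ, ∀ j, p j ≤ P.eval (n j)

namespace PolyIn

variable {J : Type} {n p q : J → ℕ}

theorem mono (h : PolyIn n p) (hq : ∀ j, q j ≤ p j) : PolyIn n q :=
  let ⟨P, hP⟩ := h
  ⟨P, fun j => (hq j).trans (hP j)⟩

theorem const (a : ℕ) : PolyIn n fun _ => a :=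
  ⟨Polynomial.C a, fun j => by simp⟩

theorem self : PolyIn n n :=
  ⟨Polynomial.X, fun j => by simp⟩

theorem add (hp : PolyIn n p) (hq : PolyIn n q) : PolyIn n fun j => p j + q j := by
  obtain ⟨P, hP⟩ := hp
  obtain ⟨Q, hQ⟩ := hq
  exact ⟨P + Q, fun j => by simpa using add_le_add (hP j) (hQ j)⟩

theorem mul (hp : PolyIn n p) (hq : PolyIn n q) : PolyIn n fun j => p j * q j := by
  obtain ⟨P, hP⟩ := hp
  obtain ⟨Q, hQ⟩ := hq
  exact ⟨P * Q, fun j => by simpa using Nat.mul_le_mul (hP j) (hQ j)⟩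

theorem comap {J' : Type} (φ : J' → J) (hp : PolyIn n p) :
    PolyIn (fun j => n (φ j)) fun j => p (φ j) :=
  let ⟨P, hP⟩ := hp
  ⟨P, fun j => hP (φ j)⟩

end PolyIn

/-- The functions of the family `f` are computed by circuits of size polynomial in `n`. Beyond the
security parameter, the index may contain constants that are built into the circuits. -/
def Feasible {J : Type} (n : J → ℕ) {α β : J → Type} [∀ j, Bits (α j)] [∀ j, Bits (β j)]
    (f : ∀ j, α j → β j) : Prop :=
  ∃ s : J → ℕ, PolyIn n s ∧ ∀ j, ComputableIn (s j) (f j)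

namespace Feasible

variable {J : Type} {n : J → ℕ} {α β γ : J → Type} [∀ j, Bits (α j)] [∀ j, Bits (β j)]
  [∀ j, Bits (γ j)]

theorem comap {J' : Type} (φ : J' → J) {f : ∀ j, α j → β j} (hf : Feasible n f) :
    Feasible (fun j => n (φ j)) fun j => f (φ j) :=
  let ⟨s, h1, h2⟩ := hf
  ⟨fun j => s (φ j), h1.comap φ, fun j => h2 (φ j)⟩

theorem of_wires {f : ∀ j, α j → β j} (g : ∀ j, Bits.Idx (β j) → Bits.Idx (α j))
    (h : ∀ j x i, Bits.enc (f j x) i = Bits.enc x (g j i)) : Feasible n f :=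
  ⟨fun _ => 0, .const 0, fun j => .of_wires (g j) (h j)⟩

theorem comp {g : ∀ j, β j → γ j} {f : ∀ j, α j → β j} (hg : Feasible n g)
    (hf : Feasible n f) : Feasible n fun j x => g j (f j x) :=
  let ⟨_, h1, h2⟩ := hf
  let ⟨_, h3, h4⟩ := hg
  ⟨_, h1.add h3, fun j => (h4 j).comp (h2 j)⟩

theorem prodMk {f : ∀ j, α j → β j} {g : ∀ j, α j → γ j} (hf : Feasible n f)
    (hg : Feasible n g) : Feasible n fun j x => (f j x, g j x) :=
  let ⟨_, h1, h2⟩ := hf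
  let ⟨_, h3, h4⟩ := hg
  ⟨_, h1.add h3, fun j => (h2 j).prodMk (h4 j)⟩

theorem id : Feasible n fun j (x : α j) => x :=
  of_wires (fun _ i => i) fun _ _ _ => rfl

theorem fst {f : ∀ j, α j → β j × γ j} (hf : Feasible n f) : Feasible n fun j x => (f j x).1 :=
  comp (g := fun j (x : β j × γ j) => x.1) (of_wires (fun _ i => .inl i) fun _ _ _ => rfl) hf

theorem snd {f : ∀ j, α j → β j × γ j} (hf : Feasible n f) : Feasible n fun j x => (f j x).2 :=
  comp (g := fun j (x : β j × γ j) => x.2) (of_wires (fun _ i => .inr i) fun _ _ _ => rfl) hf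

theorem apply {ι : J → Type} {f : ∀ j, α j → ι j → β j} (hf : Feasible n f) (i : ∀ j, ι j) :
    Feasible n fun j x => f j x (i j) :=
  comp (g := fun j (x : ι j → β j) => x (i j)) (of_wires (fun j k => (i j, k)) fun _ _ _ => rfl) hf

/-- Reading the components in another order. -/
theorem reindex {ι ι' : J → Type} {f : ∀ j, α j → ι j → β j} (hf : Feasible n f)
    (e : ∀ j, ι' j → ι j) : Feasible n fun j x i => f j x (e j i) :=
  comp (g := fun j (x : ι j → β j) i => x (e j i))
    (of_wires (fun j k => (e j k.1, k.2)) fun _ _ _ => rfl) hf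

theorem const (b : ∀ j, β j) : Feasible n fun j (_ : α j) => b j :=
  ⟨fun _ => 2, .const 2, fun j => .const (b j)⟩

theorem add {f g : ∀ j, α j → F2} (hf : Feasible n f) (hg : Feasible n g) :
    Feasible n fun j x => f j x + g j x :=
  comp (g := fun _ (x : F2 × F2) => x.1 + x.2) ⟨fun _ => 1, .const 1, fun _ => .add⟩
    (hf.prodMk hg)

theorem mul {f g : ∀ j, α j → F2} (hf : Feasible n f) (hg : Feasible n g) :
    Feasible n fun j x => f j x * g j x :=
  comp (g := fun _ (x : F2 × F2) => x.1 * x.2) ⟨fun _ => 1, .const 1, fun _ => .mul⟩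
    (hf.prodMk hg)

theorem some {f : ∀ j, α j → β j} (hf : Feasible n f) :
    Feasible n fun j x => Option.some (f j x) :=
  comp (g := fun j (x : β j) => Option.some x) ⟨fun _ => 2, .const 2, fun _ => .some⟩ hf

theorem isSome {f : ∀ j, α j → Option (β j)} (hf : Feasible n f) :
    Feasible n fun j x => if (f j x).isSome then (1 : F2) else 0 :=
  comp (g := fun j (x : Option (β j)) => if x.isSome then (1 : F2) else 0)
    (of_wires (fun _ _ => none) fun j x i => by cases x <;> rfl) hf

/-- An absent value is encoded by zeros, so if the default is encoded by zeros too, dropping the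
presence bit is all there is to do. -/
theorem getD {f : ∀ j, α j → Option (β j)} (hf : Feasible n f) (b : ∀ j, β j)
    (hb : ∀ j, Bits.enc (b j) = 0) : Feasible n fun j x => (f j x).getD (b j) :=
  comp (g := fun j (x : Option (β j)) => x.getD (b j))
    (of_wires (fun _ i => Option.some i) fun j x i => by
      cases x with
      | none => exact congrFun (hb j) i
      | some a => rfl) hf

theorem pi {ι : J → Type} [∀ j, Finite (ι j)] (hι : PolyIn n fun j => Nat.card (ι j))
    {f : ∀ j, ι j → α j → β j}
    (hf : Feasible (fun p : Σ j, ι j => n p.1) fun p => f p.1 p.2) :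
    Feasible n fun j x i => f j i x := by
  obtain ⟨s, ⟨P, hP⟩, hs⟩ := hf
  exact ⟨_, hι.mul (⟨P, fun _ => le_rfl⟩ : PolyIn n fun j => P.eval (n j)),
    fun j => .pi fun i => (hs ⟨j, i⟩).mono (hP _)⟩

theorem of_bits [∀ j, Finite (Bits.Idx (β j))]
    (hβ : PolyIn n fun j => Nat.card (Bits.Idx (β j))) {f : ∀ j, α j → β j}
    (hf : Feasible (fun p : Σ j, Bits.Idx (β j) => n p.1)
      fun p x => Bits.enc (f p.1 x) p.2) : Feasible n f := by
  obtain ⟨s, ⟨P, hP⟩, hs⟩ := hf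
  exact ⟨_, hβ.mul (⟨P, fun _ => le_rfl⟩ : PolyIn n fun j => P.eval (n j)),
    fun j => .of_bits fun i => (hs ⟨j, i⟩).mono (hP _)⟩

theorem sum {ι : J → Type} [∀ j, Fintype (ι j)] (hι : PolyIn n fun j => Fintype.card (ι j))
    {f : ∀ j, ι j → α j → F2}
    (hf : Feasible (fun p : Σ j, ι j => n p.1) fun p => f p.1 p.2) :
    Feasible n fun j x => ∑ i, f j i x := by
  obtain ⟨s, ⟨P, hP⟩, hs⟩ := hf
  have hP' : PolyIn n fun j => P.eval (n j) := ⟨P, fun _ => le_rfl⟩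
  exact ⟨_, (hι.mul (hP'.add (.const 1))).add (.const 2),
    fun j => .sum (fun i => (hs ⟨j, i⟩).mono (hP _)) _⟩

theorem prod {ι : J → Type} [∀ j, Fintype (ι j)] (hι : PolyIn n fun j => Fintype.card (ι j))
    {f : ∀ j, ι j → α j → F2}
    (hf : Feasible (fun p : Σ j, ι j => n p.1) fun p => f p.1 p.2) :
    Feasible n fun j x => ∏ i, f j i x := by
  obtain ⟨s, ⟨P, hP⟩, hs⟩ := hf
  have hP' : PolyIn n fun j => P.eval (n j) := ⟨P, fun _ => le_rfl⟩
  exact ⟨_, (hι.mul (hP'.add (.const 1))).add (.const 2),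
    fun j => .prod (fun i => (hs ⟨j, i⟩).mono (hP _)) _⟩

theorem bit {f : ∀ j, α j → β j} (hf : Feasible n f) (i : ∀ j, Bits.Idx (β j)) :
    Feasible n fun j x => Bits.enc (f j x) (i j) :=
  comp (g := fun j (x : β j) => Bits.enc x (i j))
    (of_wires (fun j _ => i j) fun _ _ _ => rfl) hf

/-- Both branches are computed and selected bitwise by the multiplexer `c * (f + g) + f` over `F2`.
-/
theorem ite [∀ j, Finite (Bits.Idx (β j))] (hβ : PolyIn n fun j => Nat.card (Bits.Idx (β j)))
    {c : ∀ j, α j → F2} {f g : ∀ j, α j → β j} (hc : Feasible n c) (hf : Feasible n f)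
    (hg : Feasible n g) : Feasible n fun j x => if c j x = 0 then f j x else g j x := by
  refine of_bits hβ ?_
  let φ : (Σ j, Bits.Idx (β j)) → J := Sigma.fst
  have h := ((hc.comap φ).mul (((hf.comap φ).bit fun p => p.2).add
    ((hg.comap φ).bit fun p => p.2))).add ((hf.comap φ).bit fun p => p.2)
  convert h using 3 with p x
  have hc : c p.1 x = 0 ∨ c p.1 x = 1 := by generalize c p.1 x = z; revert z; decide
  have h2 : ∀ a b : F2, b = 1 * (a + b) + a := by decide
  rcases hc with hc | hc
  · simp [φ, hc]
  · rw [if_neg (by simp [hc])]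
    simp only [φ, hc]
    exact h2 _ _

end Feasible

open scoped BigOperators

/-! ## Averages over uniform choices -/

/-- The indicator of the bit `1`. -/
noncomputable def accept (b : F2) : ℝ := if b = 1 then 1 else 0

theorem prOne_pure (b : F2) : prOne (pure b) = accept b := by
  unfold prOne accept
  change ((PMF.pure b) 1).toReal = _
  rw [PMF.pure_apply]
  by_cases h : b = 1
  · simp [h]
  · rw [if_neg (Ne.symm h), if_neg h]; rfl

theorem prOne_uniform_bind {Ω : Type} [Fintype Ω] [Nonempty Ω] (f : Ω → PMF F2) :
    prOne (PMF.uniformOfFintype Ω >>= f) = 𝔼 ω, prOne (f ω) := by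
  unfold prOne
  change ((PMF.bind (PMF.uniformOfFintype Ω) f) 1).toReal = _
  rw [PMF.bind_apply, tsum_fintype, ENNReal.toReal_sum, Finset.expect_eq_sum_div_card,
    Finset.sum_div]
  · refine Finset.sum_congr rfl fun a _ => ?_
    rw [PMF.uniformOfFintype_apply, ENNReal.toReal_mul, ENNReal.toReal_inv,
      ENNReal.toReal_natCast, div_eq_inv_mul, Finset.card_univ]
  · intro a _
    exact ENNReal.mul_ne_top (PMF.apply_ne_top _ _) (PMF.apply_ne_top _ _)

/-- Averaging over an additional choice that is not used. -/
theorem expect_unused {Ω : Type} [Fintype Ω] [Nonempty Ω] (a : ℝ) : (𝔼 _ω : Ω, a) = a :=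
  Fintype.expect_const a

theorem expect_prod {Ω Ω' : Type} [Fintype Ω] [Fintype Ω'] (f : Ω × Ω' → ℝ) :
    𝔼 p, f p = 𝔼 a, 𝔼 b, f (a, b) := by
  rw [← Finset.univ_product_univ, Finset.expect_product]

theorem expect_add_right {G : Type} [AddGroup G] [Fintype G] (a : G) (f : G → ℝ) :
    𝔼 g, f (g + a) = 𝔼 g, f g :=
  Fintype.expect_equiv (Equiv.addRight a) _ _ fun _ => rfl

theorem expect_apply {ι α : Type} [Fintype ι] [DecidableEq ι] [Fintype α] [Nonempty α] (i : ι)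
    (h : α → ℝ) : 𝔼 f : ι → α, h (f i) = 𝔼 a, h a := by
  rw [Fintype.expect_equiv (Equiv.funSplitAt i α) (fun f => h (f i)) (fun p => h p.1)
    fun _ => rfl, expect_prod]
  exact Finset.expect_congr rfl fun a _ => expect_unused (h a)

/-- One component of a uniform tuple may be drawn again. -/
theorem expect_resample {ι α Ω : Type} [Fintype ι] [DecidableEq ι] [Fintype α] [Nonempty α]
    [Fintype Ω] (i : ι) (h : (ι → α) × Ω → ℝ) :
    𝔼 p, h p = 𝔼 p : (ι → α) × Ω, 𝔼 a, h (Function.update p.1 i a, p.2) := by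
  -- With coordinate `i` split off, the overwritten old coordinate becomes an unused average.
  have key : ∀ g : (ι → α) → ℝ, 𝔼 f, g f = 𝔼 f, 𝔼 a, g (Function.update f i a) := by
    intro g
    let e := Equiv.funSplitAt i α
    have hu : ∀ (p : α × ({j // j ≠ i} → α)) a, Function.update (e.symm p) i a =
        e.symm (a, p.2) := by
      intro p a
      funext j
      by_cases hj : j = i
      · subst hj; simp [e]
      · simp [e, hj]
    rw [Fintype.expect_equiv e g (fun p => g (e.symm p)) fun f => by rw [e.symm_apply_apply],
      Fintype.expect_equiv e (fun f => 𝔼 a, g (Function.update f i a))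
        (fun p => 𝔼 a, g (e.symm (a, p.2))) fun f =>
          Finset.expect_congr rfl fun a _ => by rw [← hu (e f) a, e.symm_apply_apply],
      expect_prod, expect_prod]
    simp only [expect_unused]
    rw [Finset.expect_comm]
  rw [expect_prod, expect_prod, key]
  exact Finset.expect_congr rfl fun f _ => Finset.expect_comm _ _ _

/-- The source of the non-uniform advice: some fixed choice has at least the average advantage. -/
theorem abs_expect_le {Ω : Type} [Fintype Ω] [Nonempty Ω] (f : Ω → ℝ) :
    ∃ ω, |𝔼 ω, f ω| ≤ |f ω| := by
  obtain ⟨ω, -, h⟩ := Finset.exists_max_image Finset.univ (fun ω => |f ω|) Finset.univ_nonempty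
  refine ⟨ω, (Finset.abs_expect_le _ _).trans ?_⟩
  exact (Finset.expect_le_expect fun a ha => h a ha).trans_eq (expect_unused _)

theorem Negligible.mono {ε δ : ℕ → ℝ} (hε : Negligible ε) (h : ∀ κ, |δ κ| ≤ |ε κ|) :
    Negligible δ :=
  Asymptotics.SuperpolynomialDecay.trans_abs_le hε h

/-! ## Consequences of the security of the PRF -/

/-- A circuit that depends on a single value of the PRF does not tell it from a random string. -/
theorem IsSecurePRF.negligible_of_polySize {l : ℕ → ℕ} (hl : PolyBounded l)
    {F : ∀ κ, Str κ → Str κ → Str (l κ)} (hF : IsSecurePRF F) (sid : ∀ κ, Str κ)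
    {g : ∀ κ, Str (l κ) → F2} (hg : PolySize g) :
    Negligible fun κ =>
      |(𝔼 k, accept (g κ (F κ k (sid κ)))) - 𝔼 u, accept (g κ u)| := by
  obtain ⟨s, hs, hC⟩ := hg
  choose C hCs hCe using hC
  -- An oracle gate returns a single bit of the answer, so reading a whole value takes `l κ` queries
  -- at the same point.
  have hQ : ∀ κ, ∃ Q : Circuit (Fin κ) (Fin (l κ)) (Fin (l κ) × Unit) (Fin κ),
      Q.size ≤ l κ ∧ ∀ O w p, Q.eval O w p = O w p.1 := fun κ => by
    obtain ⟨Q, h1, h2⟩ := Circuit.exists_parallel (X := Fin κ) (Y := Fin (l κ)) (o := Unit) 1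
      (fun y : Fin (l κ) => Circuit.step (.query (fun i => i) y) (.done fun _ => none))
      fun _ => le_rfl
    exact ⟨Q, by simpa using h1, fun O w p => h2 O w p⟩
  choose Q hQs hQe using hQ
  -- The distinguisher is deterministic: it writes down `sid`, queries it and runs the given
  -- circuit. The identity renaming only unfolds the type of the wires.
  have h := hF.2 (fun _ => 0)
    (fun κ => (Circuit.consts (sid κ)).bind ((Q κ).bind ((C κ).rename fun i => i).lift))
    (PolyIn.const (n := id) 0) ?_
  · have he : ∀ κ (O : Str κ → Str (l κ)) ω, ((Circuit.consts (sid κ)).bind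
        ((Q κ).bind ((C κ).rename fun i => i).lift)).eval O (ω : Str 0) () =
        g κ (O (sid κ)) := by
      intro κ O ω
      rw [Circuit.eval_bind, Circuit.eval_consts, Circuit.eval_bind,
        Circuit.eval_lift O (fun _ y => y.elim), Circuit.eval_rename]
      have hq : (Q κ).eval O (sid κ) = Bits.enc (O (sid κ)) := funext fun p => hQe κ _ _ _
      rw [hq]
      exact (congrFun (hCe κ (O (sid κ))) ()).symm
    simp only [he, prOne_uniform_bind, prOne_pure, expect_unused] at h
    -- A uniformly random function has a uniform value at the single point `sid`.
    simpa only [expect_apply (α := Str (l _)) (sid _) fun u => accept (g _ u)] using h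
  · refine PolyIn.mono (n := id) (((PolyIn.const 2).add hl).add hs) fun κ => ?_
    simp only [Circuit.size_bind, Circuit.size_lift, Circuit.size_rename]
    have := hCs κ
    have := hQs κ
    have : (Circuit.consts (sid κ) :
      Circuit (Fin κ) (Fin (l κ)) (Fin κ) (Fin 0)).size = 2 := rfl
    omega

/-- The same if the circuit has random constants built in: the best ones are as good. -/
theorem IsSecurePRF.negligible_of_feasible {l : ℕ → ℕ} (hl : PolyBounded l)
    {F : ∀ κ, Str κ → Str κ → Str (l κ)} (hF : IsSecurePRF F) (sid : ∀ κ, Str κ)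
    {Ω : ℕ → Type} [∀ κ, Fintype (Ω κ)] [∀ κ, Nonempty (Ω κ)]
    {g : ∀ κ, Ω κ → Str (l κ) → F2}
    (hg : Feasible (fun p : Σ κ, Ω κ => p.1) fun p => g p.1 p.2) :
    Negligible fun κ =>
      |(𝔼 ω, 𝔼 k, accept (g κ ω (F κ k (sid κ)))) - 𝔼 ω, 𝔼 u, accept (g κ ω u)| := by
  have hmax := fun κ => abs_expect_le fun ω : Ω κ =>
    (𝔼 k, accept (g κ ω (F κ k (sid κ)))) - 𝔼 u, accept (g κ ω u)
  choose ω hω using hmax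
  refine (hF.negligible_of_polySize hl sid (g := fun κ => g κ (ω κ))
    (hg.comap (φ := fun κ => (⟨κ, ω κ⟩ : Σ κ, Ω κ)))).mono fun κ => ?_
  rw [abs_abs, abs_abs, ← Finset.expect_sub_distrib]
  exact hω κ

/-! ## Correctness of the protocol -/

theorem reconstruct_complete {α : Type} [AddCommGroup α] (c : Fin 3) (a : α × α) (val : α) :
    reconstruct (complete c a val) = val := by
  unfold reconstruct complete
  rw [Fin.sum_univ_three]
  have h0 : (0 - 1 : Fin 3) = 2 := rfl
  have h2 : (2 - 1 : Fin 3) = 1 := rfl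
  fin_cases c
  · simp [h0]; abel
  · simp; abel
  · simp [h2]

/-- The shares computed by the parties, if `z i` is the pseudorandom value of the key `i`. -/
def shares {lm l : ℕ} (T : RSS (Arr lm l)) (v : RSS (Str lm → F2)) (Δ : Str lm)
    (z : RSS (Str l)) : RSS (Str l) :=
  fun i => innerShare (piece T i) (piece v i) Δ + (z i - z (i - 1))

/-- Replicated multiplication: each of the nine products of a share of the vector and a share of the
array is computed by exactly one party. -/
theorem sum_innerShare {lm l : ℕ} (T : RSS (Arr lm l)) (v : RSS (Str lm → F2)) (Δ : Str lm) :
    ∑ i, innerShare (piece T i) (piece v i) Δ =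
      ∑ j, reconstruct v (j + Δ) • reconstruct T j := by
  have h0 : (0 - 1 : Fin 3) = 2 := rfl
  have h1 : (1 - 1 : Fin 3) = 0 := rfl
  have h2 : (2 - 1 : Fin 3) = 1 := rfl
  simp only [Fin.sum_univ_three, innerShare, piece, reconstruct, h0, h1, h2,
    ← Finset.sum_add_distrib]
  refine Finset.sum_congr rfl fun j _ => ?_
  simp only [Pi.add_apply, add_smul, smul_add]
  abel

/-- The masks telescope around the cycle, and shifting the unit vector at `r` by `r + idx` moves its
1 to `idx`, as addition is XOR. -/
theorem sum_shares {κ lm l : ℕ} (x : Input κ lm l) (v : RSS (Str lm → F2)) (r : Str lm)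
    (hv : reconstruct v = unitVec r) (z : RSS (Str l)) :
    ∑ i, shares x.T v (r + reconstruct x.idx) z i = x.selected := by
  have hz : ∑ i : Fin 3, (z i - z (i - 1)) = 0 := by
    rw [Finset.sum_sub_distrib, sub_eq_zero]
    exact (Equiv.sum_comp (Equiv.subRight (1 : Fin 3)) z).symm
  have hj : ∀ j, unitVec r (j + (r + reconstruct x.idx)) =
      if j = reconstruct x.idx then 1 else 0 := by
    intro j
    unfold unitVec
    congr 1
    rw [add_left_comm, add_eq_left, add_eq_zero_iff_eq_neg]
    have : -reconstruct x.idx = reconstruct x.idx := funext fun i => ZMod.neg_eq_self_mod_two _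
    rw [this]
  simp only [shares, Finset.sum_add_distrib, hz, add_zero, sum_innerShare, hv, hj, ite_smul,
    one_smul, zero_smul, Finset.sum_ite_eq', Finset.mem_univ, if_true]
  rfl

theorem reconstruct_add {α : Type} [AddCommGroup α] (x y : RSS α) :
    reconstruct (x + y) = reconstruct x + reconstruct y :=
  Finset.sum_add_distrib

/-! ## Efficiency of arithmetic on strings -/

namespace Feasible

variable {J : Type} {n : J → ℕ} {α : J → Type} [∀ j, Bits (α j)] {l : J → ℕ}

theorem add_str (hl : PolyIn n l) {f g : ∀ j, α j → Str (l j)} (hf : Feasible n f)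
    (hg : Feasible n g) : Feasible n fun j x => f j x + g j x := by
  refine pi (ι := fun j => Fin (l j)) (hl.mono fun j => by simp)
    (f := fun j i x => f j x i + g j x i) ?_
  let φ : (Σ j, Fin (l j)) → J := Sigma.fst
  exact add (apply (hf.comap φ) fun p => p.2) (apply (hg.comap φ) fun p => p.2)

theorem sub_str (hl : PolyIn n l) {f g : ∀ j, α j → Str (l j)} (hf : Feasible n f)
    (hg : Feasible n g) : Feasible n fun j x => f j x - g j x := by
  convert hf.add_str hl hg using 3 with j x
  rw [sub_eq_add_neg]
  congr 1
  exact funext fun i => ZMod.neg_eq_self_mod_two _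

/-- The shares as functions of one of the pseudorandom values. -/
theorem shares_update (hl : PolyIn n l) {lm : J → ℕ} (T : ∀ j, RSS (Arr (lm j) (l j)))
    (v : ∀ j, RSS (Str (lm j) → F2)) (Δ : ∀ j, Str (lm j)) (z : ∀ j, RSS (Str (l j)))
    (a i : Fin 3) {f : ∀ j, α j → Str (l j)} (hf : Feasible n f) :
    Feasible n fun j y => shares (T j) (v j) (Δ j) (Function.update (z j) a (f j y)) i := by
  have hz : ∀ b : Fin 3, Feasible n fun j y => Function.update (z j) a (f j y) b := by
    intro b
    by_cases hb : b = a
    · subst hb; simpa using hf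
    · simpa [hb] using const fun j => z j b
  -- The inner product does not involve the varying value, so it is a built-in constant and costs
  -- nothing that depends on `lm`.
  exact (const fun j => innerShare (piece (T j) i) (piece (v j) i) (Δ j)).add_str hl
    ((hz i).sub_str hl (hz (i - 1)))

end Feasible

/-! ## Executions without corrupted parties -/

/-- The sharing of `rdx` enters only through its sum, so the average over the pair `_a` is idle. -/
theorem prOne_realHonest {κ lm l r : ℕ} (F : Str κ → Str κ → Str l) (x : Input κ lm l)
    (D : (Fin 3 → Str l × Str l) × Str r → F2) :
    prOne (do
      let a ← realHonest F x
      let ω ← PMF.uniformOfFintype (Str r)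
      return D (a, ω)) =
    𝔼 k : RSS (Str κ), 𝔼 p : Str lm, 𝔼 _a : Str lm × Str lm,
      𝔼 b : (Str lm → F2) × (Str lm → F2), 𝔼 ω,
        accept (D (piece (shares x.T (complete 0 b (unitVec p)) (p + reconstruct x.idx)
          fun i => F (k i) x.sid), ω)) := by
  simp only [realHonest, freshSharing, bind_assoc, pure_bind, prOne_uniform_bind, prOne_pure,
    fOpen, reconstruct_add, reconstruct_complete]
  rfl

theorem prOne_idealHonest {κ lm l r : ℕ} (x : Input κ lm l)
    (D : (Fin 3 → Str l × Str l) × Str r → F2) :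
    prOne (do
      let a ← idealHonest x
      let ω ← PMF.uniformOfFintype (Str r)
      return D (a, ω)) =
    𝔼 a : Str l × Str l, 𝔼 ω, accept (D (piece (complete 0 a x.selected), ω)) := by
  simp only [idealHonest, freshSharing, bind_assoc, pure_bind, prOne_uniform_bind, prOne_pure]

/-- If two of the pseudorandom values are uniformly random, then so is the sharing. -/
theorem expect_shares {κ lm l : ℕ} (x : Input κ lm l) (v : RSS (Str lm → F2)) (r : Str lm)
    (hv : reconstruct v = unitVec r) (z : RSS (Str l)) (h : RSS (Str l) → ℝ) :
    𝔼 u, 𝔼 u', h (shares x.T v (r + reconstruct x.idx)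
        (Function.update (Function.update z 0 u) 2 u')) =
      𝔼 a : Str l × Str l, h (complete 0 a x.selected) := by
  have h2 : (2 - 1 : Fin 3) = 1 := rfl
  have h0 : (0 - 1 : Fin 3) = 2 := rfl
  set Δ := r + reconstruct x.idx
  set t : Fin 3 → Str l := fun i => innerShare (piece x.T i) (piece v i) Δ
  -- Shares 0 and 2 form a triangular system in `u` and `u'`: for fixed `u'`, share 0 is a translate
  -- of `u`, and share 2 is a translate of `u'`. The sum fixes share 1.
  have key : ∀ u u', shares x.T v Δ (Function.update (Function.update z 0 u) 2 u') =
      complete 0 (u + (t 0 - u'), u' + (t 2 - z 1)) x.selected := by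
    intro u u'
    rw [← sum_shares x v r hv (Function.update (Function.update z 0 u) 2 u'),
      Fin.sum_univ_three]
    funext i
    have e0 : shares x.T v Δ (Function.update (Function.update z 0 u) 2 u') 0 =
        u + (t 0 - u') := by
      simp [shares, h0, t]; abel
    have e2 : shares x.T v Δ (Function.update (Function.update z 0 u) 2 u') 2 =
        u' + (t 2 - z 1) := by
      simp [shares, h2, t]; abel
    rw [e0, e2]
    fin_cases i
    · simpa [complete] using e0
    · simp only [complete, h0]
      simp [Δ]
      abel
    · simpa [complete, h0] using e2
  simp only [key]
  rw [Finset.expect_comm, expect_prod,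
    Finset.expect_comm _ _ fun a b => h (complete 0 (a, b) x.selected),
    ← expect_add_right (t 2 - z 1) fun b => 𝔼 a, h (complete 0 (a, b) x.selected)]
  exact Finset.expect_congr rfl fun u' _ =>
    expect_add_right (t 0 - u') fun u => h (complete 0 (u, u' + (t 2 - z 1)) x.selected)

theorem Negligible.triangle {a b c : ℕ → ℝ} (h1 : Negligible fun κ => |a κ - b κ|)
    (h2 : Negligible fun κ => |b κ - c κ|) : Negligible fun κ => |a κ - c κ| :=
  Negligible.mono (Asymptotics.SuperpolynomialDecay.add h1 h2) fun κ => by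
    rw [abs_abs]
    exact (abs_sub_le _ _ _).trans (le_abs_self _)

/-- For a fixed finite set of components, each may have its own polynomial; the sum of these
polynomials bounds them all. -/
theorem Feasible.pi_const {J ι : Type} [Fintype ι] {n : J → ℕ} {α β : J → Type}
    [∀ j, Bits (α j)] [∀ j, Bits (β j)] {f : ∀ j, ι → α j → β j}
    (hf : ∀ i, Feasible n fun j => f j i) : Feasible n fun j x i => f j i x := by
  choose s hs hf using hf
  choose P hP using hs
  refine Feasible.pi (ι := fun _ => ι) (.const _) ⟨_, ⟨∑ i, P i, fun _ => le_rfl⟩, fun p =>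
    (hf p.2 p.1).mono ((hP p.2 p.1).trans ?_)⟩
  rw [Polynomial.eval_finsetSum]
  exact Finset.single_le_sum (f := fun i => (P i).eval (n p.1)) (fun _ _ => Nat.zero_le _)
    (Finset.mem_univ p.2)

theorem feasible_piece {J : Type} {n : J → ℕ} {α β : J → Type} [∀ j, Bits (α j)]
    [∀ j, Bits (β j)] {f : ∀ j, α j → RSS (β j)} (hf : ∀ i, Feasible n fun j x => f j x i) :
    Feasible n fun j x => piece (f j x) :=
  .pi_const (f := fun j i x => piece (f j x) i) fun i => (hf i).prodMk (hf (i - 1))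

/-- The random choices in the execution and of the distinguisher. -/
abbrev HonestCoins (κ lm r : ℕ) : Type :=
  RSS (Str κ) × (Str lm × (Str lm × Str lm) × ((Str lm → F2) × (Str lm → F2)) × Str r)

/-- The output of the distinguisher, given the pseudorandom values. -/
def honestBit {κ lm l r : ℕ} (x : Input κ lm l) (D : (Fin 3 → Str l × Str l) × Str r → F2)
    (ω : HonestCoins κ lm r) (z : RSS (Str l)) : F2 :=
  D (piece (shares x.T (complete 0 ω.2.2.2.1 (unitVec ω.2.1)) (ω.2.1 + reconstruct x.idx) z),
    ω.2.2.2.2)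

/-! ### The two hybrid steps for honest parties. -/

theorem prf_update {κ l : ℕ} (F : Str κ → Str κ → Str l) (sid : Str κ) (k : RSS (Str κ))
    (i : Fin 3) (a : Str κ) :
    (fun j => F (Function.update k i a j) sid) =
      Function.update (fun j => F (k j) sid) i (F a sid) :=
  funext fun j => Function.apply_update (fun _ k => F k sid) k i a j

/-- Key 0 matters only through its PRF value, so it can be drawn apart from all other choices. This
is the shape needed for the first replacement. -/
theorem prOne_realHonest_resample {κ lm l r : ℕ} (F : Str κ → Str κ → Str l)
    (x : Input κ lm l) (D : (Fin 3 → Str l × Str l) × Str r → F2) :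
    prOne (do
      let a ← realHonest F x
      let ω ← PMF.uniformOfFintype (Str r)
      return D (a, ω)) =
    𝔼 ω : HonestCoins κ lm r, 𝔼 k, accept (honestBit x D ω
      (Function.update (fun i => F (ω.1 i) x.sid) 0 (F k x.sid))) := by
  have h := expect_resample 0 fun ω : HonestCoins κ lm r =>
    accept (honestBit x D ω fun i => F (ω.1 i) x.sid)
  simp only [prf_update] at h
  refine Eq.trans ?_ h
  rw [prOne_realHonest]
  simp only [expect_prod, honestBit]

/-- The end of the first replacement is the start of the second: the uniform value for key 0 joins
the fixed choices, and key 2 is drawn afresh. -/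
theorem expect_honestBit_resample {κ lm l r : ℕ} (F : Str κ → Str κ → Str l)
    (x : Input κ lm l) (D : (Fin 3 → Str l × Str l) × Str r → F2) :
    (𝔼 ω : HonestCoins κ lm r, 𝔼 u, accept (honestBit x D ω
      (Function.update (fun i => F (ω.1 i) x.sid) 0 u))) =
    𝔼 ω : HonestCoins κ lm r × Str l, 𝔼 k, accept (honestBit x D ω.1
      (Function.update (Function.update (fun i => F (ω.1.1 i) x.sid) 0 ω.2) 2 (F k x.sid))) := by
  have h := expect_resample 2 fun ω : HonestCoins κ lm r => 𝔼 u,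
    accept (honestBit x D ω (Function.update (fun i => F (ω.1 i) x.sid) 0 u))
  simp only [prf_update] at h
  rw [h, expect_prod (Ω := HonestCoins κ lm r)]
  refine Finset.expect_congr rfl fun ω _ => ?_
  rw [Finset.expect_comm]
  refine Finset.expect_congr rfl fun u _ => Finset.expect_congr rfl fun k _ => ?_
  rw [Function.update_comm (by decide : (2 : Fin 3) ≠ 0)]
  rfl

theorem expect_honestBit_uniform {κ lm l r : ℕ} (F : Str κ → Str κ → Str l)
    (x : Input κ lm l) (D : (Fin 3 → Str l × Str l) × Str r → F2) :
    (𝔼 ω : HonestCoins κ lm r × Str l, 𝔼 u, accept (honestBit x D ω.1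
      (Function.update (Function.update (fun i => F (ω.1.1 i) x.sid) 0 ω.2) 2 u))) =
    prOne (do
      let a ← idealHonest x
      let ω ← PMF.uniformOfFintype (Str r)
      return D (a, ω)) := by
  rw [prOne_idealHonest, expect_prod (Ω := HonestCoins κ lm r)]
  have key : ∀ ω : HonestCoins κ lm r, (𝔼 u, 𝔼 u', accept (honestBit x D ω
      (Function.update (Function.update (fun i => F (ω.1 i) x.sid) 0 u) 2 u'))) =
      𝔼 a : Str l × Str l, accept (D (piece (complete 0 a x.selected), ω.2.2.2.2)) :=
    fun ω => expect_shares x _ ω.2.1 (reconstruct_complete _ _ _) _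
      fun s => accept (D (piece s, ω.2.2.2.2))
  simp only [key]
  rw [Finset.expect_comm]
  refine Finset.expect_congr rfl fun a _ => ?_
  simp only [expect_prod (Ω := RSS (Str κ)), expect_prod (Ω := Str lm),
    expect_prod (Ω := Str lm × Str lm), expect_prod (Ω := (Str lm → F2) × (Str lm → F2)),
    expect_unused]

theorem feasible_honestBit {lm l r : ℕ → ℕ} (hl : PolyBounded l) (x : ∀ κ, Input κ (lm κ) (l κ))
    {D : ∀ κ, (Fin 3 → Str (l κ) × Str (l κ)) × Str (r κ) → F2} (hD : PolySize D)
    {Ω : ℕ → Type} (a : Fin 3) (ω : ∀ κ, Ω κ → HonestCoins κ (lm κ) (r κ))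
    (z : ∀ κ, Ω κ → RSS (Str (l κ))) :
    Feasible (fun p : Σ κ, Ω κ => p.1) fun p y =>
      honestBit (x p.1) (D p.1) (ω p.1 p.2) (Function.update (z p.1 p.2) a y) := by
  let φ : (Σ κ, Ω κ) → ℕ := Sigma.fst
  exact Feasible.comp (g := fun p : Σ κ, Ω κ => D p.1) (f := fun p y =>
    (piece (shares (x p.1).T (complete 0 (ω p.1 p.2).2.2.2.1 (unitVec (ω p.1 p.2).2.1))
      ((ω p.1 p.2).2.1 + reconstruct (x p.1).idx) (Function.update (z p.1 p.2) a y)),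
      (ω p.1 p.2).2.2.2.2)) (Feasible.comap φ hD) (Feasible.prodMk
      (feasible_piece fun i => Feasible.shares_update (PolyIn.comap φ hl) _ _ _ _ a i
        Feasible.id) (Feasible.const _))

theorem compIndist_honest {lm l : ℕ → ℕ} (hl : PolyBounded l)
    {F : ∀ κ, Str κ → Str κ → Str (l κ)} (hF : IsSecurePRF F)
    (x : ∀ κ, Input κ (lm κ) (l κ)) :
    CompIndist (fun κ => realHonest (F κ) (x κ)) (fun κ => idealHonest (x κ)) := by
  intro r D _ hD
  have h1 := hF.negligible_of_feasible hl (fun κ => (x κ).sid)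
    (g := fun κ ω y => honestBit (x κ) (D κ) ω
      (Function.update (fun i => F κ (ω.1 i) (x κ).sid) 0 y))
    (feasible_honestBit hl x hD 0 (fun _ ω => ω) fun κ ω i => F κ (ω.1 i) (x κ).sid)
  have hg2 := feasible_honestBit (Ω := fun κ => HonestCoins κ (lm κ) (r κ) × Str (l κ)) hl x hD 2
    (fun _ ω => ω.1) fun κ ω => Function.update (fun i => F κ (ω.1.1 i) (x κ).sid) 0 ω.2
  have h2 := hF.negligible_of_feasible hl (fun κ => (x κ).sid)
    (Ω := fun κ => HonestCoins κ (lm κ) (r κ) × Str (l κ))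
    (g := fun κ ω y => honestBit (x κ) (D κ) ω.1 (Function.update
      (Function.update (fun i => F κ (ω.1.1 i) (x κ).sid) 0 ω.2) 2 y))
    hg2
  simp only [← prOne_realHonest_resample, expect_honestBit_resample] at h1
  simp only [expect_honestBit_uniform] at h2
  exact h1.triangle h2

/-! ## Efficiency of the shares -/

/-- Reading a table at a position that depends on the input: each factor is 1 exactly if `p` and `i
+ Δ` agree in bit `b`, so the product is the indicator of `p = i + Δ`. -/
theorem lookup_eq_sum {lm : ℕ} (v : Str lm → F2) (i Δ : Str lm) :
    v (i + Δ) = ∑ p, v p * ∏ b, (Δ b + (i b + p b + 1)) := by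
  have hb : ∀ x y z : F2, x + (y + z + 1) = if z = y + x then 1 else 0 := by decide
  have hp : ∀ p : Str lm, ∏ b, (Δ b + (i b + p b + 1)) = if p = i + Δ then 1 else 0 := by
    intro p
    simp only [hb, Finset.prod_boole, Finset.mem_univ, true_implies, funext_iff, Pi.add_apply]
  simp [hp]

namespace Feasible

variable {J : Type} {n : J → ℕ} {α : J → Type} [∀ j, Bits (α j)] {lm l : J → ℕ}

theorem lookup (hm : PolyIn n fun j => 2 ^ lm j) {v : ∀ j, α j → Str (lm j) → F2}
    {Δ : ∀ j, α j → Str (lm j)} (hv : Feasible n v) (hΔ : Feasible n Δ)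
    (i : ∀ j, Str (lm j)) : Feasible n fun j x => v j x (i j + Δ j x) := by
  simp only [lookup_eq_sum]
  refine sum (ι := fun j => Str (lm j)) (hm.mono fun j => by simp)
    (f := fun j p x => v j x p * ∏ b, (Δ j x b + (i j b + p b + 1))) ?_
  let φ : (Σ j, Str (lm j)) → J := Sigma.fst
  refine mul (apply (hv.comap φ) fun p => p.2) ?_
  refine prod (J := Σ j, Str (lm j)) (ι := fun p => Fin (lm p.1))
    -- The number of factors is bounded by `lm ≤ 2 ^ lm`.
    (PolyIn.mono (hm.comap φ) fun p => by simpa using Nat.lt_two_pow_self.le)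
    (f := fun p b x => Δ p.1 x b + (i p.1 b + p.2 b + 1)) ?_
  let ψ : (Σ p : (Σ j, Str (lm j)), Fin (lm p.1)) → J := fun q => q.1.1
  exact add (apply (hΔ.comap ψ) fun q => q.2) (const _)

theorem innerShare (hm : PolyIn n fun j => 2 ^ lm j) (hl : PolyIn n l)
    {T : ∀ j, α j → Arr (lm j) (l j) × Arr (lm j) (l j)}
    {v : ∀ j, α j → (Str (lm j) → F2) × (Str (lm j) → F2)} {Δ : ∀ j, α j → Str (lm j)}
    (hT : Feasible n T) (hv : Feasible n v) (hΔ : Feasible n Δ) :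
    Feasible n fun j x => ObliviousSelection.innerShare (T j x) (v j x) (Δ j x) := by
  refine pi (ι := fun j => Fin (l j)) (hl.mono fun j => by simp)
    (f := fun j q x => ObliviousSelection.innerShare (T j x) (v j x) (Δ j x) q) ?_
  let φ : (Σ j, Fin (l j)) → J := Sigma.fst
  simp only [ObliviousSelection.innerShare, Finset.sum_apply, Pi.add_apply, Pi.smul_apply,
    smul_eq_mul]
  refine sum (J := Σ j, Fin (l j)) (ι := fun p => Str (lm p.1))
    (PolyIn.mono (hm.comap φ) fun p => by simp [φ])
    (f := fun p i x => (v p.1 x).1 (i + Δ p.1 x) * (T p.1 x).1 i p.2 +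
      (v p.1 x).2 (i + Δ p.1 x) * (T p.1 x).1 i p.2 +
      (v p.1 x).1 (i + Δ p.1 x) * (T p.1 x).2 i p.2) ?_
  let ψ : (Σ p : (Σ j, Fin (l j)), Str (lm p.1)) → J := fun q => q.1.1
  have h1 := (hv.fst.comap ψ).lookup (hm.comap ψ) (hΔ.comap ψ) fun q => q.2
  have h2 := (hv.snd.comap ψ).lookup (hm.comap ψ) (hΔ.comap ψ) fun q => q.2
  have t1 := apply (apply (hT.fst.comap ψ) fun q => q.2) fun q => q.1.2
  have t2 := apply (apply (hT.snd.comap ψ) fun q => q.2) fun q => q.1.2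
  exact ((h1.mul t1).add (h2.mul t1)).add (h1.mul t2)

/-- A case distinction on the built-in constants alone needs no gates: the family of circuits picks
the right one for each index. -/
theorem of_or {β : J → Type} [∀ j, Bits (β j)] {f g h : ∀ j, α j → β j} (hg : Feasible n g)
    (hh : Feasible n h) (hf : ∀ j, f j = g j ∨ f j = h j) : Feasible n f := by
  obtain ⟨s, hs, hg⟩ := hg
  obtain ⟨t, ht, hh⟩ := hh
  refine ⟨_, hs.add ht, fun j => ?_⟩
  rcases hf j with e | e <;> rw [e]
  · exact (hg j).mono (Nat.le_add_right _ _)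
  · exact (hh j).mono (Nat.le_add_left _ _)

end Feasible

/-! ## The simulator -/

/-- The bit that tells whether the adversary lets the preprocessing succeed. -/
def preprocessed {κ lm l w : ℕ} (A : Adversary κ lm l w) (view : InitialView κ lm l A.coins) :
    F2 :=
  (if (A.rand view).isSome then 1 else 0) * if (A.unit view).isSome then 1 else 0

/-- The piece of the unit vector that is held by the corrupted party. -/
def unitPiece {κ lm l w : ℕ} (A : Adversary κ lm l w) (view : InitialView κ lm l A.coins) :
    (Str lm → F2) × (Str lm → F2) :=
  (A.unit view).getD (0, 0)

/-- The outcome of the execution, given the shares `s` that the parties compute. -/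
def outcome {κ lm l w : ℕ} (c : Fin 3) (A : Adversary κ lm l w)
    (view : InitialView κ lm l A.coins) (Δ : Str lm) (s : RSS (Str l)) : Outcome l w :=
  if preprocessed A view = 0 then (none, A.out (view, none, none))
  else if A.opens (view, Δ) = 0 then (none, A.out (view, some Δ, none))
  else (some ((s (c + 1), A.send (view, Δ, s (c - 1))), (s (c - 1), s (c + 1))),
    A.out (view, some Δ, some (s (c - 1))))

/-- The error is the difference between the message of the adversary and the honest one. -/
def simAnswer {κ lm l w : ℕ} (F : Str κ → Str κ → Str l) (A : Adversary κ lm l w)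
    (view : InitialView κ lm l A.coins) (Δ : Str lm) (ρ : Str l) : Option (Str l × Str l) :=
  if preprocessed A view * A.opens (view, Δ) = 0 then none
  else some (A.send (view, Δ, ρ) - maskedShare F view.2.1.2.2 view.1 view.2.1.1
    (unitPiece A view) Δ, A.send (view, Δ, ρ))

def simOut {κ lm l w : ℕ} (A : Adversary κ lm l w)
    (view : InitialView κ lm l A.coins) (Δ : Str lm) (ρ : Str l) : Str w :=
  if preprocessed A view = 0 then A.out (view, none, none)
  else if A.opens (view, Δ) = 0 then A.out (view, some Δ, none)
  else A.out (view, some Δ, some ρ)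

/-- The outcome of the ideal execution, given the random choices. -/
def simOutcome {κ lm l w : ℕ} (F : Str κ → Str κ → Str l) (c : Fin 3) (A : Adversary κ lm l w)
    (x : Input κ lm l) (view : InitialView κ lm l A.coins) (Δ : Str lm) (ρ : Str l) :
    Outcome l w :=
  ((fOs c x ρ (simAnswer F A view Δ ρ)).map fun s => (piece s (c + 1), piece s (c - 1)),
    simOut A view Δ ρ)

def Str.left {a b : ℕ} (ω : Str (a + b)) : Str a := fun i => ω (Fin.castAdd b i)

def Str.right {a b : ℕ} (ω : Str (a + b)) : Str b := fun i => ω (Fin.natAdd a i)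

theorem expect_str_add {a b : ℕ} (f : Str a → Str b → ℝ) :
    𝔼 ω : Str (a + b), f ω.left ω.right = 𝔼 u, 𝔼 v, f u v := by
  rw [← expect_prod fun p : Str a × Str b => f p.1 p.2]
  exact Fintype.expect_equiv (Fin.appendEquiv a b).symm _ _ fun _ => rfl

/-- The initial view of the adversary, from the input and the coins of the simulator. -/
def simView {κ lm l w : ℕ} (A : Adversary κ lm l w) (p : PartyInput κ lm l)
    (ω : Str (κ + (κ + (A.coins + lm)))) : InitialView κ lm l A.coins :=
  ((ω.left, ω.right.left), p, ω.right.right.left)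

/-- The simulator draws the keys of the corrupted party, the coins of the adversary, and the opened
value. -/
def simulator {κ lm l w : ℕ} (F : Str κ → Str κ → Str l) (A : Adversary κ lm l w) :
    Simulator κ lm l w where
  coins := κ + (κ + (A.coins + lm))
  answer y := simAnswer F A (simView A y.1 y.2.1) y.2.1.right.right.right y.2.2
  out y := simOut A (simView A y.1 y.2.1) y.2.1.right.right.right y.2.2

/-! ### Circuits for the simulator. -/

section SimulatorEfficiency

variable {lm l w : ℕ → ℕ} {A : ∀ κ, Adversary κ (lm κ) (l κ) (w κ)} {α : ℕ → Type}
  [∀ κ, Bits (α κ)]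

theorem feasible_preprocessed (hA : PolyAdversary A)
    {view : ∀ κ, α κ → InitialView κ (lm κ) (l κ) (A κ).coins} (hv : Feasible id view) :
    Feasible id fun κ y => preprocessed (A κ) (view κ y) :=
  (Feasible.isSome (Feasible.comp (g := fun κ => (A κ).rand) hA.rand hv)).mul
    (Feasible.isSome (Feasible.comp (g := fun κ => (A κ).unit) hA.unit hv))

theorem feasible_simOut (hw : PolyBounded w) (hA : PolyAdversary A)
    {view : ∀ κ, α κ → InitialView κ (lm κ) (l κ) (A κ).coins} (hv : Feasible id view)
    {Δ : ∀ κ, α κ → Str (lm κ)} (hΔ : Feasible id Δ)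
    {ρ : ∀ κ, α κ → Str (l κ)} (hρ : Feasible id ρ) :
    Feasible id fun κ y => simOut (A κ) (view κ y) (Δ κ y) (ρ κ y) := by
  have hfin : ∀ κ, Finite (Bits.Idx (Str (w κ))) := fun κ =>
    inferInstanceAs (Finite (Fin (w κ) × Unit))
  have hcard : PolyIn id fun κ => Nat.card (Bits.Idx (Str (w κ))) :=
    PolyIn.mono hw fun κ => (Nat.card_prod (Fin (w κ)) Unit).trans (by simp) |>.le
  have hout : ∀ {f : ∀ κ, α κ → Option (Str (lm κ))} {g : ∀ κ, α κ → Option (Str (l κ))},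
      Feasible id f → Feasible id g →
      Feasible id fun κ y => (A κ).out (view κ y, f κ y, g κ y) := fun hf hg =>
    Feasible.comp (g := fun κ => (A κ).out) hA.out (hv.prodMk (hf.prodMk hg))
  exact Feasible.ite hcard (feasible_preprocessed hA hv)
    (hout (Feasible.const fun _ => none) (Feasible.const fun _ => none))
    (Feasible.ite hcard
      (Feasible.comp (g := fun κ => (A κ).opens) hA.opens (hv.prodMk hΔ))
      (hout hΔ.some (Feasible.const fun _ => none)) (hout hΔ.some hρ.some))

theorem feasible_simAnswer (hm : PolyBounded fun κ => 2 ^ lm κ) (hl : PolyBounded l)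
    {F : ∀ κ, Str κ → Str κ → Str (l κ)}
    (hF : PolySize fun κ (x : Str κ × Str κ) => F κ x.1 x.2) (hA : PolyAdversary A)
    {view : ∀ κ, α κ → InitialView κ (lm κ) (l κ) (A κ).coins} (hv : Feasible id view)
    {Δ : ∀ κ, α κ → Str (lm κ)} (hΔ : Feasible id Δ)
    {ρ : ∀ κ, α κ → Str (l κ)} (hρ : Feasible id ρ) :
    Feasible id fun κ y => simAnswer (F κ) (A κ) (view κ y) (Δ κ y) (ρ κ y) := by
  have hfin : ∀ κ, Finite (Bits.Idx (Option (Str (l κ) × Str (l κ)))) := fun κ =>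
    inferInstanceAs (Finite (Option (Fin (l κ) × Unit ⊕ Fin (l κ) × Unit)))
  have hcard : PolyIn id fun κ => Nat.card (Bits.Idx (Option (Str (l κ) × Str (l κ)))) :=
    PolyIn.mono ((PolyIn.add hl hl).add (.const 1)) fun κ => by
      change Nat.card (Option (Fin (l κ) × Unit ⊕ Fin (l κ) × Unit)) ≤ _
      simp
  have hsend := Feasible.comp (g := fun κ => (A κ).send) hA.send (hv.prodMk (hΔ.prodMk hρ))
  have hunit : Feasible id fun κ y => unitPiece (A κ) (view κ y) :=
    Feasible.getD (Feasible.comp (g := fun κ => (A κ).unit) hA.unit hv) (fun _ => (0, 0))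
      fun κ => funext fun i => by rcases i with i | i <;> rfl
  -- The simulator evaluates the PRF itself on the keys that it has drawn, hence the need for an
  -- efficient `F`.
  have hprf : ∀ {k : ∀ κ, α κ → Str κ}, Feasible id k →
      Feasible id fun κ y => F κ (k κ y) (view κ y).2.1.2.2 := fun hk =>
    Feasible.comp (g := fun κ (x : Str κ × Str κ) => F κ x.1 x.2) hF
      (hk.prodMk hv.snd.fst.snd.snd)
  exact Feasible.ite hcard ((feasible_preprocessed hA hv).mul
      (Feasible.comp (g := fun κ => (A κ).opens) hA.opens (hv.prodMk hΔ)))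
    (Feasible.const fun _ => none)
    (((hsend.sub_str hl ((Feasible.innerShare hm hl hv.snd.fst.fst hunit hΔ).add_str hl
      ((hprf hv.fst.fst).sub_str hl (hprf hv.fst.snd)))).prodMk hsend).some)

theorem polySimulator_simulator (hm : PolyBounded fun κ => 2 ^ lm κ) (hl : PolyBounded l)
    (hw : PolyBounded w) {F : ∀ κ, Str κ → Str κ → Str (l κ)}
    (hF : PolySize fun κ (x : Str κ × Str κ) => F κ x.1 x.2) (hA : PolyAdversary A) :
    PolySimulator fun κ => simulator (F κ) (A κ) := by
  have hω : Feasible id fun κ (y : PartyInput κ (lm κ) (l κ) ×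
      Str (κ + (κ + ((A κ).coins + lm κ))) × Str (l κ)) => y.2.1 := Feasible.id.snd.fst
  have hview : Feasible id fun κ (y : PartyInput κ (lm κ) (l κ) ×
      Str (κ + (κ + ((A κ).coins + lm κ))) × Str (l κ)) => simView (A κ) y.1 y.2.1 :=
    ((hω.reindex fun κ => Fin.castAdd _).prodMk (hω.reindex fun κ i =>
      Fin.natAdd _ (Fin.castAdd _ i))).prodMk (Feasible.id.fst.prodMk
      (hω.reindex fun κ i => Fin.natAdd _ (Fin.natAdd _ (Fin.castAdd _ i))))
  have hΔ : Feasible id fun κ (y : PartyInput κ (lm κ) (l κ) ×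
      Str (κ + (κ + ((A κ).coins + lm κ))) × Str (l κ)) => y.2.1.right.right.right :=
    hω.reindex fun κ i => Fin.natAdd _ (Fin.natAdd _ (Fin.natAdd _ i))
  have hlm : PolyBounded lm := PolyIn.mono hm fun κ => Nat.lt_two_pow_self.le
  exact {
    coins := PolyIn.self.add (PolyIn.self.add (PolyIn.add hA.coins hlm))
    answer := feasible_simAnswer hm hl hF hA hview hΔ Feasible.id.snd.snd
    out := feasible_simOut hw hA hview hΔ Feasible.id.snd.snd }

end SimulatorEfficiency

/-! ## Executions with a corrupted party -/

theorem piece_complete_self {α : Type} [AddCommGroup α] (c : Fin 3) (a : α × α) (val : α) :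
    piece (complete c a val) c = a := by
  have h : c - 1 ≠ c := by revert c; decide
  simp [piece, complete, h]

theorem piece_complete_next {α : Type} [AddCommGroup α] (c : Fin 3) (a : α × α) (val : α) :
    piece (complete c a val) (c + 1) = (val - a.1 - a.2, a.1) := by
  have h : c + 1 ≠ c ∧ c + 1 ≠ c - 1 := by revert c; decide
  simp [piece, complete, h]

theorem piece_complete_prev {α : Type} [AddCommGroup α] (c : Fin 3) (a : α × α) (val : α) :
    piece (complete c a val) (c - 1) = (a.2, val - a.1 - a.2) := by
  have h : c - 1 ≠ c ∧ c - 1 - 1 ≠ c ∧ c - 1 - 1 ≠ c - 1 := by revert c; decide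
  simp [piece, complete, h]

theorem sum_eq_around {α : Type} [AddCommGroup α] (c : Fin 3) (s : Fin 3 → α) :
    ∑ i, s i = s c + s (c + 1) + s (c - 1) := by
  rw [Fin.sum_univ_three]
  fin_cases c
  · rfl
  · change _ = s 1 + s 2 + s 0
    abel
  · change _ = s 2 + s 0 + s 1
    abel

theorem expect_sub_left {G : Type} [AddGroup G] [Fintype G] (a : G) (f : G → ℝ) :
    𝔼 g, f (a - g) = 𝔼 g, f g :=
  Fintype.expect_equiv (Equiv.subLeft a) _ _ fun _ => rfl

/-- The shares computed in the real execution, if `z i` is the pseudorandom value of key `i`. -/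
def execShares {κ lm l w : ℕ} (c : Fin 3) (A : Adversary κ lm l w) (x : Input κ lm l)
    (view : InitialView κ lm l A.coins) (p : Str lm) (z : RSS (Str l)) : RSS (Str l) :=
  shares x.T (complete c (unitPiece A view) (unitVec p)) (p + reconstruct x.idx) z

/-- An aborted run makes fewer draws; averaging over the missing ones changes nothing, so all
branches fit under the same averages. -/
theorem prOne_realExec {κ lm l w r : ℕ} (F : Str κ → Str κ → Str l) (c : Fin 3)
    (A : Adversary κ lm l w) (x : Input κ lm l) (D : Outcome l w × Str r → F2) :
    prOne (do
      let a ← realExec F c A x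
      let ω ← PMF.uniformOfFintype (Str r)
      return D (a, ω)) =
    𝔼 k : RSS (Str κ), 𝔼 ω : Str A.coins, 𝔼 p : Str lm, 𝔼 d,
      accept (D (outcome c A (piece k c, x.party c, ω) (p + reconstruct x.idx)
        (execShares c A x (piece k c, x.party c, ω) p fun i => F (k i) x.sid), d)) := by
  simp only [realExec, bind_assoc, prOne_uniform_bind]
  refine Finset.expect_congr rfl fun k _ => Finset.expect_congr rfl fun ω _ => ?_
  generalize hview : ((piece k c, x.party c, ω) : InitialView κ lm l A.coins) = view
  cases ha : A.rand view with
  | none =>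
    simp only [outcome, preprocessed, ha, pure_bind, prOne_uniform_bind, prOne_pure]
    simp
  | some a =>
    simp only [fRand, bind_assoc, pure_bind, prOne_uniform_bind]
    refine Finset.expect_congr rfl fun p _ => ?_
    cases hb : A.unit view with
    | none =>
      simp only [outcome, preprocessed, hb, pure_bind, prOne_uniform_bind, prOne_pure]
      simp
    | some b =>
      simp only [fOpen, f3pc, reconstruct_add, reconstruct_complete]
      by_cases ho : A.opens (view, p + reconstruct x.idx) = 0
      · simp only [outcome, preprocessed, ha, hb, ho, if_true, pure_bind, prOne_uniform_bind,
          prOne_pure]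
        simp
      · simp only [outcome, preprocessed, ha, hb, ho, if_false, pure_bind, prOne_uniform_bind,
          prOne_pure, execShares, unitPiece]
        simp only [Option.isSome_some, if_true, mul_one, one_ne_zero, if_false, Option.getD_some]
        rfl

theorem prOne_idealExec {κ lm l w r : ℕ} (F : Str κ → Str κ → Str l) (c : Fin 3)
    (A : Adversary κ lm l w) (x : Input κ lm l) (D : Outcome l w × Str r → F2) :
    prOne (do
      let a ← idealExec c (simulator F A) x
      let ω ← PMF.uniformOfFintype (Str r)
      return D (a, ω)) =
    𝔼 k : Str κ, 𝔼 k' : Str κ, 𝔼 ω : Str A.coins, 𝔼 Δ : Str lm, 𝔼 ρ, 𝔼 d,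
      accept (D (simOutcome F c A x ((k, k'), x.party c, ω) Δ ρ, d)) := by
  simp only [idealExec, bind_assoc, pure_bind, prOne_uniform_bind, prOne_pure]
  refine Eq.trans (expect_str_add (a := κ) (b := κ + (A.coins + lm)) fun k ω => 𝔼 ρ, 𝔼 d,
    accept (D (simOutcome F c A x ((k, ω.left), x.party c, ω.right.left) ω.right.right ρ, d))) ?_
  refine Finset.expect_congr rfl fun k _ => ?_
  refine Eq.trans (expect_str_add fun k' (ω : Str (A.coins + lm)) => 𝔼 ρ, 𝔼 d,
    accept (D (simOutcome F c A x ((k, k'), x.party c, ω.left) ω.right ρ, d))) ?_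
  refine Finset.expect_congr rfl fun k' _ => ?_
  exact expect_str_add fun ω Δ => 𝔼 ρ, 𝔼 d,
    accept (D (simOutcome F c A x ((k, k'), x.party c, ω) Δ ρ, d))

/-- If the pseudorandom value that is unknown to the corrupted party is replaced by a uniformly
random one, then the simulation is perfect. -/
theorem expect_outcome {κ lm l w : ℕ} (F : Str κ → Str κ → Str l) (c : Fin 3)
    (A : Adversary κ lm l w) (x : Input κ lm l) (k : RSS (Str κ)) (ω : Str A.coins)
    (p : Str lm) (h : Outcome l w → ℝ) :
    𝔼 u, h (outcome c A (piece k c, x.party c, ω) (p + reconstruct x.idx)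
        (execShares c A x (piece k c, x.party c, ω) p
          (Function.update (fun i => F (k i) x.sid) (c + 1) u))) =
      𝔼 ρ, h (simOutcome F c A x (piece k c, x.party c, ω) (p + reconstruct x.idx) ρ) := by
  -- The last equation says that the unknown key `c + 1` is the one subtracted in the mask of party
  -- `c - 1`.
  have hc : c ≠ c + 1 ∧ c - 1 ≠ c + 1 ∧ c - 1 - 1 = c + 1 := by revert c; decide
  set view : InitialView κ lm l A.coins := (piece k c, x.party c, ω) with hview
  set Δ := p + reconstruct x.idx with hΔ
  set v := complete c (unitPiece A view) (unitVec p) with hv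
  -- The substitution `ρ = s (c - 1)` is a reflection `u ↦ a - u`, which preserves the uniform
  -- distribution.
  refine Eq.trans ?_ (expect_sub_left (innerShare (piece x.T (c - 1)) (piece v (c - 1)) Δ +
    F (k (c - 1)) x.sid) fun ρ => h (simOutcome F c A x view Δ ρ))
  refine Finset.expect_congr rfl fun u _ => congrArg h ?_
  set s := execShares c A x view p (Function.update (fun i => F (k i) x.sid) (c + 1) u) with hs
  have hprev : innerShare (piece x.T (c - 1)) (piece v (c - 1)) Δ + F (k (c - 1)) x.sid - u =
      s (c - 1) := by
    simp only [hs, execShares, shares]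
    rw [hc.2.2, Function.update_self, Function.update_of_ne hc.2.1, add_sub_assoc]
  have hself : maskedShare F view.2.1.2.2 view.1 view.2.1.1 (unitPiece A view) Δ = s c := by
    have hpiece : piece v c = unitPiece A view := piece_complete_self _ _ _
    simp only [hs, execShares, shares]
    rw [← hv, ← hΔ, Function.update_of_ne hc.1, Function.update_of_ne hc.2.1, hpiece]
    rfl
  have hnext : s (c + 1) = x.selected - s c - s (c - 1) := by
    have := sum_shares x v p (reconstruct_complete _ _ _)
      (Function.update (fun i => F (k i) x.sid) (c + 1) u)
    rw [sum_eq_around c] at this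
    change s c + s (c + 1) + s (c - 1) = _ at this
    rw [← this]
    abel
  rw [hprev]
  unfold outcome simOutcome simAnswer simOut
  by_cases h1 : preprocessed A view = 0
  · simp [h1, fOs]
  by_cases h2 : A.opens (view, Δ) = 0
  · simp [h1, h2, fOs]
  · simp only [h1, h2, if_false, mul_eq_zero, or_self, fOs, Option.map_some,
      piece_complete_next, piece_complete_prev, hself]
    -- The message of the adversary cancels against the error, leaving the honest share of party `c
    -- + 1`.
    have : x.selected + (A.send (view, Δ, s (c - 1)) - s c) - A.send (view, Δ, s (c - 1)) -
        s (c - 1) = s (c + 1) := by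
      rw [hnext]; abel
    rw [this]

theorem expect_two {α : Type} [Fintype α] [Nonempty α] (c : Fin 3) (h : α × α → ℝ) :
    𝔼 k : RSS α, h (piece k c) = 𝔼 a, 𝔼 b, h (a, b) := by
  have hc : c - 1 ≠ c := by revert c; decide
  have e := expect_resample (ι := Fin 3) (α := α) (Ω := Unit) c fun q => h (piece q.1 c)
  simp only [expect_prod (Ω' := Unit), expect_unused, piece, Function.update_self,
    Function.update_of_ne hc] at e
  refine Eq.trans e ?_
  rw [Finset.expect_comm]
  exact Finset.expect_congr rfl fun a _ => expect_apply (c - 1) fun b => h (a, b)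

/-- The random choices in the execution and of the distinguisher. -/
abbrev ExecCoins (κ lm a r : ℕ) : Type := RSS (Str κ) × (Str a × Str lm × Str r)

/-- The output of the distinguisher, given the pseudorandom values. -/
def execBit {κ lm l w r : ℕ} (c : Fin 3) (A : Adversary κ lm l w) (x : Input κ lm l)
    (D : Outcome l w × Str r → F2) (k : Str κ × Str κ) (ω : Str A.coins × Str lm × Str r)
    (z : RSS (Str l)) : F2 :=
  D (outcome c A (k, x.party c, ω.1) (ω.2.1 + reconstruct x.idx)
    (execShares c A x (k, x.party c, ω.1) ω.2.1 z), ω.2.2)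

/-- Key `c + 1` is not in the view of `c`, so redrawing it affects nothing but one pseudorandom
value. -/
theorem prOne_realExec_resample {κ lm l w r : ℕ} (F : Str κ → Str κ → Str l) (c : Fin 3)
    (A : Adversary κ lm l w) (x : Input κ lm l) (D : Outcome l w × Str r → F2) :
    prOne (do
      let a ← realExec F c A x
      let ω ← PMF.uniformOfFintype (Str r)
      return D (a, ω)) =
    𝔼 ω : ExecCoins κ lm A.coins r, 𝔼 k, accept (execBit c A x D (piece ω.1 c) ω.2
      (Function.update (fun i => F (ω.1 i) x.sid) (c + 1) (F k x.sid))) := by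
  have hc : c ≠ c + 1 ∧ c - 1 ≠ c + 1 := by revert c; decide
  have h := expect_resample (c + 1) fun ω : ExecCoins κ lm A.coins r =>
    accept (execBit c A x D (piece ω.1 c) ω.2 fun i => F (ω.1 i) x.sid)
  have hp : ∀ (k : RSS (Str κ)) a, piece (Function.update k (c + 1) a) c = piece k c := by
    intro k a
    simp [piece, hc]
  simp only [prf_update, hp] at h
  refine Eq.trans ?_ h
  rw [prOne_realExec]
  simp only [expect_prod, execBit]

theorem expect_execBit_uniform {κ lm l w r : ℕ} (F : Str κ → Str κ → Str l) (c : Fin 3)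
    (A : Adversary κ lm l w) (x : Input κ lm l) (D : Outcome l w × Str r → F2) :
    (𝔼 ω : ExecCoins κ lm A.coins r, 𝔼 u, accept (execBit c A x D (piece ω.1 c) ω.2
      (Function.update (fun i => F (ω.1 i) x.sid) (c + 1) u))) =
    prOne (do
      let a ← idealExec c (simulator F A) x
      let ω ← PMF.uniformOfFintype (Str r)
      return D (a, ω)) := by
  have key : ∀ (k : RSS (Str κ)) (ω : Str A.coins) (p : Str lm) (d : Str r),
      (𝔼 u, accept (execBit c A x D (piece k c) (ω, p, d)
        (Function.update (fun i => F (k i) x.sid) (c + 1) u))) =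
      𝔼 ρ, accept (D (simOutcome F c A x (piece k c, x.party c, ω)
        (p + reconstruct x.idx) ρ, d)) :=
    fun k ω p d => expect_outcome F c A x k ω p fun o => accept (D (o, d))
  rw [prOne_idealExec, expect_prod]
  simp only [expect_prod (Ω := Str A.coins), expect_prod (Ω := Str lm), key]
  rw [expect_two c fun k => 𝔼 ω, 𝔼 p, 𝔼 d, 𝔼 ρ, accept (D (simOutcome F c A x
    (k, x.party c, ω) (p + reconstruct x.idx) ρ, d))]
  refine Finset.expect_congr rfl fun k _ => Finset.expect_congr rfl fun k' _ =>
    Finset.expect_congr rfl fun ω _ => ?_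
  -- One-time pad: as `rdx` is uniform, so is `Δ`, independently of `idx`.
  rw [expect_add_right (reconstruct x.idx) fun Δ => 𝔼 d, 𝔼 ρ, accept (D (simOutcome F c A x
    ((k, k'), x.party c, ω) Δ ρ, d))]
  exact Finset.expect_congr rfl fun Δ _ => Finset.expect_comm _ _ _

/-- The adversary decides about aborting before it sees any share. Hence the branch depends on
built-in constants only, and just the last message and the output are computed from the challenge
`y`. -/
theorem feasible_execBit {lm l w r : ℕ → ℕ} (hl : PolyBounded l) (c : Fin 3)
    {A : ∀ κ, Adversary κ (lm κ) (l κ) (w κ)} (hA : PolyAdversary A)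
    (x : ∀ κ, Input κ (lm κ) (l κ))
    {D : ∀ κ, Outcome (l κ) (w κ) × Str (r κ) → F2} (hD : PolySize D)
    {Ω : ℕ → Type} (a : Fin 3) (k : ∀ κ, Ω κ → Str κ × Str κ)
    (ω : ∀ κ, Ω κ → Str (A κ).coins × Str (lm κ) × Str (r κ))
    (z : ∀ κ, Ω κ → RSS (Str (l κ))) :
    Feasible (fun p : Σ κ, Ω κ => p.1) fun p y =>
      execBit c (A p.1) (x p.1) (D p.1) (k p.1 p.2) (ω p.1 p.2)
        (Function.update (z p.1 p.2) a y) := by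
  let φ : (Σ κ, Ω κ) → ℕ := Sigma.fst
  let view : ∀ p : Σ κ, Ω κ, InitialView p.1 (lm p.1) (l p.1) (A p.1).coins := fun p =>
    (k p.1 p.2, (x p.1).party c, (ω p.1 p.2).1)
  let Δ : ∀ p : Σ κ, Ω κ, Str (lm p.1) := fun p => (ω p.1 p.2).2.1 + reconstruct (x p.1).idx
  let s : ∀ p : Σ κ, Ω κ, Str (l p.1) → RSS (Str (l p.1)) := fun p y =>
    execShares c (A p.1) (x p.1) (view p) (ω p.1 p.2).2.1 (Function.update (z p.1 p.2) a y)
  have hs : ∀ i, Feasible (fun p => φ p) fun p y => s p y i := fun i =>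
    Feasible.shares_update (PolyIn.comap φ hl) _ _ _ _ a i Feasible.id
  have hsend : Feasible (fun p => φ p) fun (p : Σ κ, Ω κ) y =>
      (A p.1).send (view p, Δ p, s p y (c - 1)) :=
    Feasible.comp (g := fun p : Σ κ, Ω κ => (A p.1).send) (Feasible.comap φ hA.send)
      (Feasible.prodMk (Feasible.const view) (Feasible.prodMk (Feasible.const Δ) (hs (c - 1))))
  have hout : Feasible (fun p => φ p) fun (p : Σ κ, Ω κ) y =>
      (A p.1).out (view p, some (Δ p), some (s p y (c - 1))) :=
    Feasible.comp (g := fun p : Σ κ, Ω κ => (A p.1).out) (Feasible.comap φ hA.out)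
      (Feasible.prodMk (Feasible.const view) (Feasible.prodMk
        (Feasible.const fun p => some (Δ p)) (hs (c - 1)).some))
  have houtcome : Feasible (fun p => φ p) fun (p : Σ κ, Ω κ) y =>
      outcome c (A p.1) (view p) (Δ p) (s p y) := by
    refine Feasible.of_or (Feasible.const fun p : (Σ κ, Ω κ) => outcome c (A p.1) (view p) (Δ p) 0)
      (Feasible.prodMk (Feasible.some (Feasible.prodMk ((hs (c + 1)).prodMk hsend)
        ((hs (c - 1)).prodMk (hs (c + 1))))) hout) fun p => ?_
    by_cases h1 : preprocessed (A p.1) (view p) = 0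
    · exact .inl (funext fun y => by simp [outcome, h1])
    by_cases h2 : (A p.1).opens (view p, Δ p) = 0
    · exact .inl (funext fun y => by simp [outcome, h2])
    · exact .inr (funext fun y => by simp [outcome, h1, h2])
  exact Feasible.comp (g := fun p : Σ κ, Ω κ => D p.1) (Feasible.comap φ hD)
    (houtcome.prodMk (Feasible.const fun p : (Σ κ, Ω κ) => (ω p.1 p.2).2.2))

theorem compIndist_corrupted {lm l w : ℕ → ℕ} (hl : PolyBounded l)
    {F : ∀ κ, Str κ → Str κ → Str (l κ)} (hF : IsSecurePRF F) (c : Fin 3)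
    {A : ∀ κ, Adversary κ (lm κ) (l κ) (w κ)} (hA : PolyAdversary A)
    (x : ∀ κ, Input κ (lm κ) (l κ)) :
    CompIndist (fun κ => realExec (F κ) c (A κ) (x κ))
      (fun κ => idealExec c (simulator (F κ) (A κ)) (x κ)) := by
  intro r D _ hD
  have hg := feasible_execBit (Ω := fun κ => ExecCoins κ (lm κ) (A κ).coins (r κ)) hl c hA x hD
    (c + 1) (fun _ ω => piece ω.1 c) (fun _ ω => ω.2) fun κ ω i => F κ (ω.1 i) (x κ).sid
  have h := hF.negligible_of_feasible hl (fun κ => (x κ).sid)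
    (Ω := fun κ => ExecCoins κ (lm κ) (A κ).coins (r κ))
    (g := fun κ ω y => execBit c (A κ) (x κ) (D κ) (piece ω.1 c) ω.2
      (Function.update (fun i => F κ (ω.1 i) (x κ).sid) (c + 1) y)) hg
  simpa only [← prOne_realExec_resample, expect_execBit_uniform] using h

end ObliviousSelection

theorem mainTheorem1 (lm l : ℕ → ℕ)
    (hm : ObliviousSelection.PolyBounded fun κ => 2 ^ lm κ)
    (hl : ObliviousSelection.PolyBounded l)
    (F : ∀ κ, ObliviousSelection.Str κ → ObliviousSelection.Str κ →
      ObliviousSelection.Str (l κ))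
    (hF : ObliviousSelection.IsSecurePRF F) :
    ObliviousSelection.SecurelyComputesOS lm l F :=
  ⟨fun c _ A hw hA => ⟨fun κ => ObliviousSelection.simulator (F κ) (A κ),
    ObliviousSelection.polySimulator_simulator hm hl hw hF.1 hA,
    ObliviousSelection.compIndist_corrupted hl hF c hA⟩,
  ObliviousSelection.compIndist_honest hl hF⟩
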